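/- Let $\rho$ be a probability density on $\mathbb R$ and $\rho_d(x)=\prod_{\ell=1}^d\rho(x_\ell)$. For each $\gamma>0$ let $K_\gamma:\mathbb R\times\mathbb R\to\mathbb R$ be a measurable, symmetric, positive definite kernel (all Gram matrices are positive semidefinite), and let $\tilde\lambda_{\gamma,1}\ge\tilde\lambda_{\gamma,2}\ge\cdots\ge0$ be the eigenvalues, with multiplicity (continued by zeros if there are finitely many), of the operator $f\mapsto\int_{\mathbb R}f(t)K_\gamma(\cdot,t)\rho(t)\,dt$ on the reproducing kernel Hilbert space with kernel $K_\gamma$. Assume $$\sum_{j=1}^\infty\tilde\lambda_{\gamma,j}=\int_{\mathbb R}K_\gamma(t,t)\rho(t)\,dt=1\qquad\text{for all }\gamma>0 .$$ Let $\alpha_\ell\in[0,1]$ and $\gamma_\ell>0$ for $\ell\in\mathbb N=\{1,2,\dots\}$, and let $\mathcal H_d$ be the reproducing kernel Hilbert space on $\mathbb R^d$ with kernel $$\widetilde K_d(x,t)=\prod_{\ell=1}^d\bigl(1-\alpha_\ell^2+\alpha_\ell^2K_{\gamma_\ell}(x_\ell,t_\ell)\bigr).$$ Let $e(n,\mathcal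 H_d)$ be the infimum, over all linear algorithms $A_nf=\sum_{j=1}^nL_j(f)a_j$ with arbitrary $L_j\in\mathcal H_d^*$ and $a_j\in L_2(\mathbb R^d,\rho_d)$, of the worst case error $\sup_{\|f\|_{\mathcal H_d}\le1}\|f-A_nf\|_{L_2(\mathbb R^d,\rho_d)}$, and for $\varepsilon\in(0,1)$ let $n(\varepsilon,\mathcal H_d)=\min\{n: e(n,\mathcal H_d)\le\varepsilon\}$ (absolute error criterion). The problem is polynomially tractable if there are $C,p,q$ with $n(\varepsilon,\mathcal H_d)\le C\,d^{\,q}\varepsilon^{-p}$ for all $d\in\mathbb N$ and $\varepsilon\in(0,1)$; it is strongly polynomially tractable if this is possible with $q=0$, and the infimum of the $p$ that are then admissible is its exponent of strong polynomial tractability. Put $$\tilde r=\sup\Bigl\{\beta>0:\ \sum_{\ell=1}^\infty(\alpha_\ell\gamma_\ell)^{1/\beta}<\infty\Bigr\}\in[0,\infty],\qquad \sup\emptyset=0 .$$ Suppose that there are constants $C_1,C_2,C_3>0$ such that $$\int_{\mathbb R^2}K_\gamma(x,t)\rho(x)\rho(t)\,dx\,dt\ \ge\ 1-C_1\gamma^2,\tag{gtc1}$$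 $$C_2\ \le\ \sum_{j=2}^\infty\Bigl(\frac{\tilde\lambda_{\gamma,j}}{\gamma^2}\Bigr)^{\frac1{2\tilde r}}\ \le\ C_3\tag{gtc2}$$ for all $\gamma>0$ that satisfy $\gamma\le\gamma_\ell$ for some $\ell$. Here, if $\tilde r=0$, (gtc2) is read as $C_2\le\sup_{j\ge2}\tilde\lambda_{\gamma,j}/\gamma^2=\tilde\lambda_{\gamma,2}/\gamma^2\le C_3$; if $\tilde r=\infty$, it is read as follows: for every $s>0$ there is a constant $C_3(s)$, independent of $\gamma$, with $\sum_{j\ge2}(\tilde\lambda_{\gamma,j}/\gamma^2)^s\le C_3(s)$. Then, with the conventions $1/0=\infty$ and $1/\infty=0$: 1. The problem is strongly polynomially tractable with exponent $p^{\rm all}=\min(2,1/\tilde r)$. 2. $e(n,\mathcal H_d)\preceq n^{-1/p^{\rm all}}=n^{-\max(\tilde r,1/2)}$ as $n\to\infty$, and $n(\varepsilon,\mathcal H_d)\preceq\varepsilon^{-p^{\rm all}}$ as $\varepsilon\to0$. Here $\preceq n^{q}$ means: for every real $s>q$ there is a constant $C$, independent of $n$ and $d$, such that the quantity is at most $Cn^{s}$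 for all $n,d\in\mathbb N$; and $\preceq\varepsilon^{-p}$ means: for every real $s>p$ there is a constant $C$, independent of $\varepsilon$ and $d$, such that the quantity is at most $C\varepsilon^{-s}$ for all $\varepsilon\in(0,1)$ and $d\in\mathbb N$. 3. If $\alpha_\ell=\alpha>0$ and $\gamma_\ell=\gamma$ for all $\ell$ (the isotropic kernel), then the exponent of strong polynomial tractability is $2$, and strong polynomial tractability is equivalent to polynomial tractability. -/

import Mathlib

open MeasureTheory Matrix
open scoped ENNReal

noncomputable section

namespace ProductKernelApprox

/-! ### Positive definite kernels and their reproducing kernel Hilbert spaces -/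

/-- A real symmetric positive definite kernel on `X`: for all finitely many points the Gram matrix
is symmetric and positive semidefinite. -/
structure PDKernel (X : Type*) where
  /-- the kernel function -/
  toFun : X → X → ℝ
  /-- symmetry and positive semidefiniteness -/
  posSemidef : (Matrix.of toFun).PosSemidef

instance {X : Type*} : CoeFun (PDKernel X) (fun _ => X → X → ℝ) := ⟨PDKernel.toFun⟩

/-- The kernel, with the real number `K x y` regarded as the operator of multiplication by it. -/
def PDKernel.opKernel {X : Type*} (K : PDKernel X) : Matrix X X (ℝ →L[ℝ] ℝ) :=
  Matrix.of fun x y => K x y • ContinuousLinearMap.id ℝ ℝ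

theorem PDKernel.opKernel_posSemidef {X : Type*} (K : PDKernel X) : K.opKernel.PosSemidef := by
  have tfae := RKHS.posSemidef_tfae (K := K.opKernel)
  refine (tfae.out 0 2 rfl rfl).mpr ⟨?_, fun v => ?_⟩
  · ext x y
    have h := K.posSemidef.isHermitian.apply x y
    simp only [Matrix.of_apply, star_trivial] at h
    simp [PDKernel.opKernel, Matrix.conjTranspose_apply, h, ContinuousLinearMap.star_eq_adjoint,
      ContinuousLinearMap.adjoint_id]
  · have h := K.posSemidef.2 v
    rw [Finsupp.sum_comm] at h
    simpa [PDKernel.opKernel, mul_comm, mul_left_comm, mul_assoc] using h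

instance {X : Type*} (K : PDKernel X) : Fact K.opKernel.PosSemidef := ⟨K.opKernel_posSemidef⟩

/-- The reproducing kernel Hilbert space of real functions on `X` with reproducing kernel `K`. -/
abbrev PDKernel.space {X : Type*} (K : PDKernel X) : Type _ := RKHS.OfKernel K.opKernel

/-- The reproducing kernel of `K.space` is `K`. -/
theorem PDKernel.kernel_space {X : Type*} (K : PDKernel X) (x y : X) :
    RKHS.kernel K.space x y 1 = K x y := by
  rw [RKHS.OfKernel.kernel_ofKernel]
  simp [PDKernel.opKernel]

/-- The kernel `1 - a² + a² K(x,t)` for a scale parameter `a ∈ [0,1]`. -/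
def hatKernel {X : Type*} (a : unitInterval) (K : PDKernel X) : PDKernel X where
  toFun x t := 1 - (a : ℝ) ^ 2 + (a : ℝ) ^ 2 * K x t
  posSemidef := by
    have ha : (0 : ℝ) ≤ 1 - (a : ℝ) ^ 2 := by nlinarith [a.2.1, a.2.2]
    have h1 : (Matrix.of fun _ _ : X => (1 : ℝ)).PosSemidef := by
      refine ⟨by ext; simp, fun v => ?_⟩
      have : (v.sum fun _ xi => v.sum fun _ xj => xi * xj) =
          (v.sum fun _ xi => xi) * (v.sum fun _ xi => xi) := by
        simp [Finsupp.sum, Finset.sum_mul_sum]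
      simp only [star_trivial, Matrix.of_apply, mul_one, this]
      exact mul_self_nonneg _
    have h := (h1.smul ha).add (K.posSemidef.smul (sq_nonneg (a : ℝ)))
    convert! h using 1
    ext x y
    simp

/-- The product kernel `∏_ℓ (1 - α_ℓ² + α_ℓ² K_{γ_ℓ}(x_ℓ,t_ℓ))` on `ℝ^d`. -/
def prodKernel (K : ℝ → PDKernel ℝ) (α : ℕ → unitInterval) (γ : ℕ → ℝ) (d : ℕ) :
    PDKernel (Fin d → ℝ) where
  toFun x t := ∏ l : Fin d, hatKernel (α l) (K (γ l)) (x l) (t l)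
  posSemidef := by
    classical
    have key : ∀ s : Finset (Fin d), (Matrix.of fun x t : Fin d → ℝ =>
        ∏ l ∈ s, hatKernel (α l) (K (γ l)) (x l) (t l)).PosSemidef := by
      intro s
      induction s using Finset.induction_on with
      | empty =>
        have h := (hatKernel (X := Fin d → ℝ) 0 ⟨fun _ _ => 0, Matrix.PosSemidef.zero⟩).posSemidef
        convert! h using 1
        ext x y
        simp [hatKernel]
      | insert l s hl ih =>
        have h := ((hatKernel (α l) (K (γ l))).posSemidef.submatrix
          (fun x : Fin d → ℝ => x l)).hadamard ih
        convert! h using 1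
        ext x y
        simp [Finset.prod_insert hl, Matrix.hadamard]
    exact key Finset.univ

/-! ### Eigenvalues of the integral operator -/

/-- `f ∈ H(K)` satisfies `W f = m f`, where `(W f)(x) = ∫ f(t) K(x,t) dμ(t)`. -/
def IsEigen {X : Type*} [MeasurableSpace X] (K : PDKernel X) (μ : Measure X) (m : ℝ)
    (f : K.space) : Prop :=
  ∀ x : X, ∫ t, f t * K x t ∂μ = m * f x

/-- The eigenvalues of `W` on `H(K)` in weakly decreasing order, counted with multiplicity and
starting from the index `0`; they are continued by zeros if there are finitely many. That is, the
`j`-th one is the largest number such that there are `j + 1` orthonormal eigenfunctions whose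
eigenvalues are all at least this number. -/
def eigenvalue {X : Type*} [MeasurableSpace X] (K : PDKernel X) (μ : Measure X) (j : ℕ) : ℝ :=
  sSup {m : ℝ | ∃ (η : Fin (j + 1) → K.space) (c : Fin (j + 1) → ℝ),
    Orthonormal ℝ η ∧ (∀ i, IsEigen K μ (c i) (η i)) ∧ ∀ i, m ≤ c i}

/-! ### Minimal worst case errors and information complexity -/

/-- The measure on `ℝ` with density `ρ`. -/
def densMeasure (ρ : ℝ → ℝ) : Measure ℝ := volume.withDensity fun x => ENNReal.ofReal (ρ x)

/-- The measure on `ℝ^d` with density `ρ(x_1) ⋯ ρ(x_d)`. -/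
def densMeasurePi (ρ : ℝ → ℝ) (d : ℕ) : Measure (Fin d → ℝ) :=
  Measure.pi fun _ => densMeasure ρ

/-- Worst case error `sup_{‖f‖ ≤ 1} ‖f - ∑_j L_j(f) a_j‖_{L₂(μ)}` of the linear algorithm given by
continuous linear functionals `L_j` and functions `a_j`. -/
def worstCaseError {X : Type*} [MeasurableSpace X] (K : PDKernel X) (μ : Measure X) {n : ℕ}
    (L : Fin n → (K.space →L[ℝ] ℝ)) (a : Fin n → X → ℝ) : ℝ≥0∞ :=
  ⨆ (f : K.space) (_ : ‖f‖ ≤ 1), eLpNorm (fun x => f x - ∑ j, L j f * a j x) 2 μ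

/-- The `n`-th minimal worst case error over all linear algorithms that use `n` arbitrary
continuous linear functionals and functions `a_j ∈ L₂(μ)`. -/
def minError {X : Type*} [MeasurableSpace X] (K : PDKernel X) (μ : Measure X) (n : ℕ) : ℝ≥0∞ :=
  ⨅ (L : Fin n → (K.space →L[ℝ] ℝ)) (a : Fin n → X → ℝ) (_ : ∀ j, MemLp (a j) 2 μ),
    worstCaseError K μ L a

/-- Information complexity for the absolute error criterion: the least `n` whose minimal error
is at most `ε` (`⊤` if there is none). -/
def infoComplexity {X : Type*} [MeasurableSpace X] (K : PDKernel X) (μ : Measure X) (ε : ℝ) : ℕ∞ :=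
  ⨅ (n : ℕ) (_ : minError K μ n ≤ ENNReal.ofReal ε), (n : ℕ∞)

/-- The minimal errors `e(n, H_d)` of the problem with the product kernels. -/
def errAll (ρ : ℝ → ℝ) (K : ℝ → PDKernel ℝ) (α : ℕ → unitInterval) (γ : ℕ → ℝ) (n d : ℕ) : ℝ≥0∞ :=
  minError (prodKernel K α γ d) (densMeasurePi ρ d) n

/-- The information complexity `n(ε, H_d)` of the problem with the product kernels. -/
def complAll (ρ : ℝ → ℝ) (K : ℝ → PDKernel ℝ) (α : ℕ → unitInterval) (γ : ℕ → ℝ) (ε : ℝ) (d : ℕ) :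
    ℕ∞ :=
  infoComplexity (prodKernel K α γ d) (densMeasurePi ρ d) ε

/-! ### Tractability -/

/-- `N ε d ≤ C d^q ε^{-p}` for all `d ≥ 1` and `ε ∈ (0,1)`. -/
def TractBound (N : ℝ → ℕ → ℕ∞) (C p q : ℝ) : Prop :=
  ∀ d : ℕ, 1 ≤ d → ∀ ε : ℝ, 0 < ε → ε < 1 →
    (N ε d : ℝ≥0∞) ≤ ENNReal.ofReal (C * (d : ℝ) ^ q * ε ^ (-p))

/-- Polynomial tractability. -/
def PolyTractable (N : ℝ → ℕ → ℕ∞) : Prop := ∃ C p q : ℝ, TractBound N C p q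

/-- Strong polynomial tractability. -/
def StrongPolyTractable (N : ℝ → ℕ → ℕ∞) : Prop := ∃ C p : ℝ, TractBound N C p 0

/-- `p` is the exponent of strong polynomial tractability: the infimum of the admissible
exponents. -/
def IsStrongExponent (N : ℝ → ℕ → ℕ∞) (p : ℝ) : Prop :=
  IsGLB {p' : ℝ | ∃ C : ℝ, TractBound N C p' 0} p

/-- `u n d ⪯ n^q` as `n → ∞`: for every real `s > q` (that is, `s = q + δ` with `δ > 0` if `q` is
finite) the quantity is at most `C n^s` for all `n, d ≥ 1`, with `C` independent of `n` and `d`. -/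
def PrecN (u : ℕ → ℕ → ℝ≥0∞) (q : EReal) : Prop :=
  ∀ s : ℝ, q < (s : EReal) → ∃ C : ℝ, 0 < C ∧ ∀ d : ℕ, 1 ≤ d → ∀ n : ℕ, 1 ≤ n →
    u n d ≤ ENNReal.ofReal (C * (n : ℝ) ^ s)

/-- `N ε d ⪯ ε^q` as `ε → 0`, that is, `⪯ (1/ε)^{-q}` as `1/ε → ∞`. -/
def PrecEps (N : ℝ → ℕ → ℕ∞) (q : EReal) : Prop :=
  ∀ s : ℝ, -q < (s : EReal) → ∃ C : ℝ, 0 < C ∧ ∀ d : ℕ, 1 ≤ d → ∀ ε : ℝ, 0 < ε → ε < 1 →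
    (N ε d : ℝ≥0∞) ≤ ENNReal.ofReal (C * (1 / ε) ^ s)

/-! ### The decay rate and the conditions on the eigenvalues -/

/-- The decay rate `sup {β > 0 | ∑_ℓ (α_ℓ γ_ℓ)^{1/β} < ∞} ∈ [0,∞]`, with `sup ∅ = 0`. -/
def decayRate (α : ℕ → unitInterval) (γ : ℕ → ℝ) : ℝ≥0∞ :=
  ⨆ (β : ℝ) (_ : 0 < β ∧ Summable fun l => ((α l : ℝ) * γ l) ^ (1 / β)), ENNReal.ofReal β

/-- The exponent `min(2, 1/r)`, where `1/0 = ∞` and `1/∞ = 0`. -/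
def pAll (r : ℝ≥0∞) : ℝ := (min 2 r⁻¹).toReal

/-- The shape parameters `γ > 0` that do not exceed all the `γ_ℓ`, that is, those in
`(0, sup γ_ℓ)`, together with the supremum if it is attained. -/
def shapeRange (γ : ℕ → ℝ) : Set ℝ := {g | 0 < g ∧ ∃ l, g ≤ γ l}

/-- The sum `∑_{j ≥ 2} (λ_{γ,j} / γ²)^s` (the index starts at `0` here). -/
def tailSum (K : ℝ → PDKernel ℝ) (μ : Measure ℝ) (s g : ℝ) : ℝ≥0∞ :=
  ∑' j : ℕ, ENNReal.ofReal ((eigenvalue (K g) μ (j + 1) / g ^ 2) ^ s)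

/-- Two-sided bounds on `∑_{j ≥ 2} (λ_{γ,j} / γ²)^{1/(2r)}`, uniformly in `γ ∈ S`. For `r = 0` they
are bounds on the corresponding supremum (the limit of the norm in `ℓ^s` as `s → ∞`), which is the
term `j = 2`, since the eigenvalues are decreasing; for `r = ∞` the upper bound is asked for
each exponent `s > 0`, with a constant that may depend on `s`. -/
def TailCondition (K : ℝ → PDKernel ℝ) (μ : Measure ℝ) (S : Set ℝ) (r : ℝ≥0∞) : Prop :=
  (r = 0 → ∃ C₂ C₃ : ℝ, 0 < C₂ ∧ 0 < C₃ ∧ ∀ g ∈ S,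
    C₂ ≤ eigenvalue (K g) μ 1 / g ^ 2 ∧ eigenvalue (K g) μ 1 / g ^ 2 ≤ C₃) ∧
  (r ≠ 0 → r ≠ ∞ → ∃ C₂ C₃ : ℝ, 0 < C₂ ∧ 0 < C₃ ∧ ∀ g ∈ S,
    ENNReal.ofReal C₂ ≤ tailSum K μ (1 / (2 * r.toReal)) g ∧
      tailSum K μ (1 / (2 * r.toReal)) g ≤ ENNReal.ofReal C₃) ∧
  (r = ∞ → ∀ s : ℝ, 0 < s → ∃ C₃ : ℝ, 0 < C₃ ∧ ∀ g ∈ S, tailSum K μ s g ≤ ENNReal.ofReal C₃)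

end ProductKernelApprox

end

/-!
The worst case setting over a reproducing kernel Hilbert space `H(K)` is a question about the
embedding `A : H(K) → L₂(μ)`: the operator `f ↦ ∫ f(t) K(·,t) dμ(t)` is `A† A`, the functions
`A† g` are `x ↦ ∫ g(t) K(t,x) dμ(t)`, and Bessel's inequality for the elements `K(·,x)` bounds the
squared Hilbert–Schmidt norm of `A` by `∫ K(t,t) dμ(t)` (`Admissible.hsBound`). So `A` is compact
and has a singular system, the eigenvalues of the problem are the sorted squares of the singular
numbers (`IsSingularSystem.lt_sqSingular_iff`), and `e(n)²` is the eigenvalue with index `n` when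
the count starts from `0` (`Admissible.minError_eq`). No separability is assumed; a part of `H(K)`
that vanishes almost everywhere is in the kernel of `A`, and a family of eigenvectors only has to be
complete modulo this kernel.

For one factor `1 - α² + α² K`, the operator `A A†` on `L₂(μ)` is `α²` times that of `K` plus
`1 - α²` times the projection onto the constants. Hence the eigenvalues `λ̂` of the factor satisfy
`α² λ_j ≤ λ̂_j` and `λ̂_{j+1} ≤ α² λ_j`, they have sum `1` because traces are additive, and
testing with the constant function gives `λ̂_0 ≥ 1 - C₁ α² γ²`. The products of the eigenfunctions
of the factors are eigenfunctions of the product kernel. Their eigenvalues exhaust the trace, so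
there are no others (`HSBound.isSingularSystem_of_hasSum`), and the power sums of the eigenvalues
are multiplicative (`tsum_eigenvalue_prod_rpow`).

The theorem is now about the products of the sums `∑_j λ̂_{l,j}^s`. Such a sum is at most
`1 + C (α_l γ_l)^{2s}` if the sums `∑_j (λ_j / γ²)^s` are bounded
(`Setting.tsum_hat_rpow_le`), so `∑_l (α_l γ_l)^{2s} < ∞` bounds the power sums of all
product kernels, and the errors decay like `n^{-1/(2s)}`; the trace alone gives the rate `1 / 2`.
Conversely, for `s < 1` the sum is at least `1 + c (α_l γ_l)^{2s}`
(`Setting.le_tsum_hat_rpow`), so a dimension-independent bound with an exponent `p < 2 s` makes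
`∑_l (α_l γ_l)^{2s}` converge, which is impossible when `1 / (2s)` exceeds the decay rate.
-/

namespace ProductKernelApprox

open scoped InnerProductSpace

/-! ### Hilbert–Schmidt operators and singular systems -/

section Hilbert

variable {H L : Type} [NormedAddCommGroup H] [InnerProductSpace ℝ H]
  [NormedAddCommGroup L] [InnerProductSpace ℝ L]

/-- `B` bounds `∑ ‖A e_i‖²` over all finite orthonormal families; in other words, `A` is a
Hilbert–Schmidt operator whose squared Hilbert–Schmidt norm is at most `B`. -/
def HSBound (A : H →L[ℝ] L) (B : ℝ) : Prop :=
  ∀ (κ : Type) [Fintype κ] (e : κ → H), Orthonormal ℝ e → ∑ i, ‖A (e i)‖ ^ 2 ≤ B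

theorem orthonormal_option {κ : Type} {e : κ → H} (he : Orthonormal ℝ e) {f : H} (hf : ‖f‖ = 1)
    (hfe : ∀ i, ⟪e i, f⟫_ℝ = 0) : Orthonormal ℝ (fun o : Option κ => o.elim f e) := by
  constructor
  · rintro (_ | i)
    · exact hf
    · exact he.1 i
  · rintro (_ | i) (_ | j) hij
    · exact absurd rfl hij
    · simpa [real_inner_comm] using hfe j
    · exact hfe i
    · exact he.2 fun h => hij (congrArg some h)

/-- On the orthogonal complement of a finite orthonormal family, the norm of `A` is controlled by
the part of the Hilbert–Schmidt norm that the family does not use up. -/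
theorem HSBound.norm_sq_le {A : H →L[ℝ] L} {B : ℝ} (hB : HSBound A B) {κ : Type} [Fintype κ]
    {e : κ → H} (he : Orthonormal ℝ e) {f : H} (hfe : ∀ i, ⟪e i, f⟫_ℝ = 0) :
    ‖A f‖ ^ 2 ≤ (B - ∑ i, ‖A (e i)‖ ^ 2) * ‖f‖ ^ 2 := by
  rcases eq_or_ne f 0 with rfl | hf
  · simp
  have hf' : ‖f‖ ≠ 0 := norm_ne_zero_iff.2 hf
  have h := hB (Option κ) _ (orthonormal_option (f := ‖f‖⁻¹ • f) he
    (by rw [norm_smul, norm_inv, norm_norm, inv_mul_cancel₀ hf'])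
    (fun i => by rw [inner_smul_right, hfe i, mul_zero]))
  rw [Fintype.sum_option] at h
  simp only [Option.elim, map_smul, norm_smul, norm_inv, norm_norm, mul_pow] at h
  have : ‖A f‖ ^ 2 = ‖f‖⁻¹ ^ 2 * ‖A f‖ ^ 2 * ‖f‖ ^ 2 := by field_simp
  rw [this]
  gcongr
  linarith

theorem inner_sub_sum_eq {I : Type} {η : I → H} (h : Orthonormal ℝ η) (s : Finset I) (f : H)
    (i : I) [Decidable (i ∈ s)] :
    ⟪η i, f - ∑ k ∈ s, ⟪η k, f⟫_ℝ • η k⟫_ℝ = if i ∈ s then 0 else ⟪η i, f⟫_ℝ := by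
  classical
  rw [inner_sub_right, inner_sum]
  simp only [inner_smul_right, orthonormal_iff_ite.1 h, mul_ite, mul_one, mul_zero,
    Finset.sum_ite_eq]
  split_ifs <;> simp

theorem norm_sub_sum_sq {I : Type} {η : I → H} (h : Orthonormal ℝ η) (s : Finset I) (f : H) :
    ‖f - ∑ k ∈ s, ⟪η k, f⟫_ℝ • η k‖ ^ 2 ≤ ‖f‖ ^ 2 := by
  classical
  set p := ∑ k ∈ s, ⟪η k, f⟫_ℝ • η k with hp
  have h0 : ⟪p, f - p⟫_ℝ = 0 := by
    conv_lhs => rw [hp, sum_inner]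
    refine Finset.sum_eq_zero fun i hi => ?_
    rw [inner_smul_left, ← hp, hp, inner_sub_sum_eq h s f i, if_pos hi, mul_zero]
  have h1 : ‖p + (f - p)‖ ^ 2 = ‖p‖ ^ 2 + ‖f - p‖ ^ 2 := by
    rw [@norm_add_sq_real, h0]; ring
  rw [add_sub_cancel] at h1
  nlinarith [sq_nonneg ‖p‖]

/-- A subspace whose dimension exceeds the number of given functionals contains a nonzero
common zero of them; this is what drives all the minimax arguments. -/
theorem exists_ne_zero_of_card_lt_finrank {E : Type} [AddCommGroup E]
    [Module ℝ E] {κ : Type} [Fintype κ] (ℓ : κ → E →ₗ[ℝ] ℝ) (V : Submodule ℝ E)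
    (hV : Fintype.card κ < Module.finrank ℝ V) : ∃ f ∈ V, f ≠ 0 ∧ ∀ k, ℓ k f = 0 := by
  have : FiniteDimensional ℝ V := FiniteDimensional.of_finrank_pos (by omega)
  have hker := LinearMap.ker_ne_bot_of_finrank_lt (f := (LinearMap.pi ℓ).comp V.subtype)
    (by simpa using hV)
  obtain ⟨f, hf, hf0⟩ := (Submodule.ne_bot_iff _).1 hker
  refine ⟨f, f.2, fun h => hf0 (Subtype.ext h), fun k => ?_⟩
  exact congrFun (LinearMap.mem_ker.1 hf) k

theorem HSBound.norm_image_sq_le {A : H →L[ℝ] L} {B : ℝ} (hB : HSBound A B) {e : H}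
    (he : ‖e‖ = 1) : ‖A e‖ ^ 2 ≤ B := by
  simpa using hB (Fin 1) (fun _ => e)
    ⟨fun _ => he, fun i j hij => absurd (Subsingleton.elim i j) hij⟩

theorem norm_sum_smul_sq {κ : Type} [Fintype κ] {η : κ → H} (hη : Orthonormal ℝ η) (x : κ → ℝ) :
    ‖∑ i, x i • η i‖ ^ 2 = ∑ i, x i ^ 2 := by
  rw [← real_inner_self_eq_norm_sq, hη.inner_sum]
  simp [sq]

variable [CompleteSpace L]

/-- A Hilbert–Schmidt operator is compact, being a norm limit of operators of finite rank. -/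
theorem HSBound.isCompactOperator {A : H →L[ℝ] L} {B : ℝ} (hB : HSBound A B) :
    IsCompactOperator A := by
  -- `T` is the smallest bound, the squared Hilbert–Schmidt norm
  set S : Set ℝ := {x | ∃ (n : ℕ) (e : Fin n → H), Orthonormal ℝ e ∧ x = ∑ i, ‖A (e i)‖ ^ 2}
  have hbdd : BddAbove S := ⟨B, by rintro _ ⟨n, e, he, rfl⟩; exact hB _ e he⟩
  have hne : S.Nonempty := ⟨_, 0, Fin.elim0, ⟨fun i => i.elim0, fun i => i.elim0⟩, rfl⟩
  have hT : HSBound A (sSup S) := by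
    intro κ _ e he
    refine le_csSup hbdd ⟨Fintype.card κ, e ∘ (Fintype.equivFin κ).symm,
      he.comp _ (Equiv.injective _), ?_⟩
    exact (Equiv.sum_comp (Fintype.equivFin κ).symm (fun i => ‖A (e i)‖ ^ 2)).symm
  have hcl : A ∈ closure {T : H →L[ℝ] L | IsCompactOperator T} := by
    rw [Metric.mem_closure_iff]
    intro ε hε
    obtain ⟨x, ⟨n, e, he, rfl⟩, hx⟩ := exists_lt_of_lt_csSup hne
      (show sSup S - (ε / 2) ^ 2 < sSup S by nlinarith)
    refine ⟨∑ i, (innerSL ℝ (e i)).smulRight (A (e i)), ?_, ?_⟩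
    · change IsCompactOperator (_ : H →L[ℝ] L)
      have : ∀ s : Finset (Fin n), IsCompactOperator
          (∑ i ∈ s, (innerSL ℝ (e i)).smulRight (A (e i)) : H →L[ℝ] L) := by
        intro s
        induction s using Finset.induction_on with
        | empty => simpa using! isCompactOperator_zero
        | insert i s hi ih =>
          rw [Finset.sum_insert hi]
          refine IsCompactOperator.add ?_ ih
          exact (isCompactOperator_of_locallyCompactSpace_rng
            (ContinuousLinearMap.toSpanSingleton ℝ (A (e i)))).comp_clm (innerSL ℝ (e i))
      exact this _
    · rw [dist_eq_norm]
      refine lt_of_le_of_lt (ContinuousLinearMap.opNorm_le_bound _ (half_pos hε).le fun f => ?_)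
        (half_lt_self hε)
      set f' := f - ∑ i, ⟪e i, f⟫_ℝ • e i with hf'
      have h1 : (A - ∑ i, (innerSL ℝ (e i)).smulRight (A (e i))) f = A f' := by
        simp [hf', map_sum]
      have h2 := hT.norm_sq_le he (f := f') (fun i => by
        classical
        rw [hf', inner_sub_sum_eq he]; simp)
      have h3 : ‖f'‖ ^ 2 ≤ ‖f‖ ^ 2 := norm_sub_sum_sq he _ f
      rw [h1]
      refine abs_le_of_sq_le_sq' ?_ (by positivity) |>.2
      rw [mul_pow]
      refine h2.trans (mul_le_mul (by linarith) h3 (by positivity) (by positivity))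
  rwa [IsClosed.closure_eq isClosed_setOfPred_isCompactOperator] at hcl

variable [CompleteSpace H]

/-- An orthonormal family of eigenvectors `η i` of `A† A` for positive eigenvalues `w i` that is
complete modulo the kernel of `A`. -/
structure IsSingularSystem {I : Type} (A : H →L[ℝ] L) (η : I → H) (w : I → ℝ) : Prop where
  orthonormal : Orthonormal ℝ η
  pos : ∀ i, 0 < w i
  eigen : ∀ i, A.adjoint (A (η i)) = w i • η i
  complete : ∀ f, (∀ i, ⟪η i, f⟫_ℝ = 0) → A f = 0

/-- The squared singular numbers of `A` in decreasing order, starting from the index `0`, defined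
like `eigenvalue` by the eigenvectors of `A† A`. If `A† A` has fewer than `j + 1` orthonormal
eigenvectors, this is `sSup ∅ = 0`. -/
noncomputable def sqSingular (A : H →L[ℝ] L) (j : ℕ) : ℝ :=
  sSup {m : ℝ | ∃ (η : Fin (j + 1) → H) (c : Fin (j + 1) → ℝ),
    Orthonormal ℝ η ∧ (∀ i, A.adjoint (A (η i)) = c i • η i) ∧ ∀ i, m ≤ c i}

theorem adjoint_self_symm (A : H →L[ℝ] L) (f g : H) :
    ⟪A.adjoint (A f), g⟫_ℝ = ⟪f, A.adjoint (A g)⟫_ℝ := by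
  rw [ContinuousLinearMap.adjoint_inner_left, ContinuousLinearMap.adjoint_inner_right]

theorem inner_image_eq {A : H →L[ℝ] L} {f : H} {c : ℝ} (h : A.adjoint (A f) = c • f) (g : H) :
    ⟪A f, A g⟫_ℝ = c * ⟪f, g⟫_ℝ := by
  rw [← ContinuousLinearMap.adjoint_inner_left, h, inner_smul_left]; rfl

theorem norm_image_sq_eq {A : H →L[ℝ] L} {f : H} {c : ℝ} (h : A.adjoint (A f) = c • f) :
    ‖A f‖ ^ 2 = c * ‖f‖ ^ 2 := by
  rw [← real_inner_self_eq_norm_sq, inner_image_eq h, real_inner_self_eq_norm_sq]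

/-- The spectral theorem for `A† A`. -/
theorem HSBound.exists_isSingularSystem {A : H →L[ℝ] L} {B : ℝ} (hB : HSBound A B) :
    ∃ (I : Type) (η : I → H) (w : I → ℝ), IsSingularSystem A η w := by
  set W : H →L[ℝ] H := A.adjoint ∘L A with hW
  have hsymm : (W : H →ₗ[ℝ] H).IsSymmetric := fun f g => adjoint_self_symm A f g
  have hcomp : IsCompactOperator W := hB.isCompactOperator.clm_comp A.adjoint
  have hbot := ContinuousLinearMap.orthogonalComplement_iSup_eigenspaces_eq_bot hcomp hsymm
  let E : {m : ℝ // m ≠ 0} → Submodule ℝ H := fun m =>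
    Module.End.eigenspace (W : Module.End ℝ H) m
  have hmem : ∀ (m : {m : ℝ // m ≠ 0}) (f : H), f ∈ E m ↔ A.adjoint (A f) = m.1 • f := fun m f =>
    Module.End.mem_eigenspace_iff
  have hclosed : ∀ m, IsClosed (E m : Set H) := fun m => by
    have : (E m : Set H) = {f | A.adjoint (A f) = m.1 • f} := Set.ext fun f => hmem m f
    rw [this]
    exact isClosed_eq (by fun_prop) (by fun_prop)
  have : ∀ m, CompleteSpace (E m) := fun m => (hclosed m).completeSpace_coe
  choose s b hb using fun m => exists_hilbertBasis ℝ (E m)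
  have horth : OrthogonalFamily ℝ (fun m => E m) fun m => (E m).subtypeₗᵢ :=
    OrthogonalFamily.comp hsymm.orthogonalFamily_eigenspaces Subtype.val_injective
  have hη := horth.orthonormal_sigma_orthonormal (fun m => (b m).orthonormal)
  have heig : ∀ a : Σ m, s m, A.adjoint (A ((E a.1).subtypeₗᵢ (b a.1 a.2))) =
      a.1.1 • (E a.1).subtypeₗᵢ (b a.1 a.2) := fun a => (hmem a.1 _).1 (b a.1 a.2).2
  refine ⟨Σ m, s m, _, fun a => a.1.1, hη, fun a => ?_, heig, fun f hf => ?_⟩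
  · have h := norm_image_sq_eq (heig a)
    rw [hη.1 a] at h
    refine lt_of_le_of_ne ?_ a.1.2.symm
    have := sq_nonneg ‖A ((E a.1).subtypeₗᵢ (b a.1 a.2))‖
    linarith
  · -- `A† A f` is orthogonal to all eigenspaces
    have hfE : ∀ m, ∀ v ∈ E m, ⟪f, v⟫_ℝ = 0 := by
      intro m v hv
      have h := (b m).hasSum_repr ⟨v, hv⟩
      have h' := (h.mapL (E m).subtypeL).mapL (innerSL ℝ f)
      refine h'.unique ?_
      convert! (hasSum_zero : HasSum (fun _ : s m => (0 : ℝ)) 0) using 2 with i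
      have := hf ⟨m, i⟩
      rw [real_inner_comm] at this
      simpa [inner_smul_right] using Or.inr this
    have h0 : A.adjoint (A f) ∈ (⨆ μ, Module.End.eigenspace (W : Module.End ℝ H) μ)ᗮ := by
      rw [Submodule.mem_orthogonal']
      intro u hu
      induction hu using Submodule.iSup_induction' with
      | mem m v hv =>
        rw [adjoint_self_symm]
        have hv' : A.adjoint (A v) = m • v := Module.End.mem_eigenspace_iff.1 hv
        rw [hv', inner_smul_right]
        rcases eq_or_ne m 0 with rfl | hm
        · simp
        · rw [hfE ⟨m, hm⟩ v hv, mul_zero]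
      | zero => simp
      | add x y _ _ hx hy => rw [inner_add_right, hx, hy, add_zero]
    rw [hbot, Submodule.mem_bot] at h0
    have := norm_image_sq_eq (A := A) (f := f) (c := 0) (by rw [h0, zero_smul])
    simpa using this

/-- An orthonormal family of eigenvectors that exhausts the Hilbert–Schmidt norm is complete. -/
theorem HSBound.isSingularSystem_of_hasSum {A : H →L[ℝ] L} {B : ℝ} (hB : HSBound A B) {I : Type}
    {η : I → H} {w : I → ℝ} (hη : Orthonormal ℝ η) (hw : ∀ i, 0 < w i)
    (he : ∀ i, A.adjoint (A (η i)) = w i • η i) (hsum : HasSum w B) :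
    IsSingularSystem A η w := by
  refine ⟨hη, hw, he, fun f hf => ?_⟩
  have key : ∀ s : Finset I, ‖A f‖ ^ 2 ≤ (B - ∑ i ∈ s, w i) * ‖f‖ ^ 2 := by
    intro s
    have h := hB.norm_sq_le (hη.comp ((↑) : s → I) Subtype.val_injective) (f := f)
      (fun i => hf i)
    have h2 : ∑ i : s, ‖A ((η ∘ ((↑) : s → I)) i)‖ ^ 2 = ∑ i ∈ s, w i := by
      rw [← Finset.sum_coe_sort s]
      refine Finset.sum_congr rfl fun i _ => ?_
      rw [Function.comp_apply, norm_image_sq_eq (he i), hη.1 i]; ring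
    rwa [h2] at h
  have hlim : Filter.Tendsto (fun s : Finset I => (B - ∑ i ∈ s, w i) * ‖f‖ ^ 2) Filter.atTop
      (nhds ((B - B) * ‖f‖ ^ 2)) := (tendsto_const_nhds.sub hsum).mul_const _
  have := ge_of_tendsto' hlim key
  have h0 : ‖A f‖ ^ 2 = 0 := le_antisymm (by simpa using this) (sq_nonneg _)
  simpa using h0

namespace IsSingularSystem

variable {I : Type} {A : H →L[ℝ] L} {η : I → H} {w : I → ℝ}

/-- Parseval's identity along a singular system if one of the vectors is orthogonal to the kernel of
`A`: the vectors that extend the system to a Hilbert basis lie in that kernel. -/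
theorem hasSum_of_kernel (h : IsSingularSystem A η w) (u v : H)
    (hv : ∀ e, A e = 0 → ⟪e, v⟫_ℝ = 0) :
    HasSum (fun i => ⟪u, η i⟫_ℝ * ⟪η i, v⟫_ℝ) ⟪u, v⟫_ℝ := by
  obtain ⟨s, b, hs, hb⟩ := h.orthonormal.toSubtypeRange.exists_hilbertBasis_extension
  let g : I → s := fun i => ⟨η i, hs ⟨i, rfl⟩⟩
  have hg : Function.Injective g := fun i j hij =>
    h.orthonormal.linearIndependent.injective (congrArg Subtype.val hij)
  have := b.hasSum_inner_mul_inner u v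
  rw [← hg.hasSum_iff] at this
  · simpa [hb, g, Function.comp_def] using this
  · intro e he
    have hbe : b e = (e : H) := by rw [hb]
    rw [hv (b e), mul_zero]
    refine h.complete _ fun i => ?_
    have hne : g i ≠ e := fun hh => he ⟨i, hh⟩
    have : ⟪b (g i), b e⟫_ℝ = 0 := b.orthonormal.2 hne
    rwa [show b (g i) = η i by rw [hb]] at this

theorem hasSum_norm_sq (h : IsSingularSystem A η w) (f : H) :
    HasSum (fun i => w i * ⟪η i, f⟫_ℝ ^ 2) (‖A f‖ ^ 2) := by
  have := h.hasSum_of_kernel f (A.adjoint (A f)) (fun e he => by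
    rw [ContinuousLinearMap.adjoint_inner_right, he, inner_zero_left])
  rw [ContinuousLinearMap.adjoint_inner_right, real_inner_self_eq_norm_sq] at this
  convert this using 2 with i
  rw [← adjoint_self_symm, h.eigen, inner_smul_left, real_inner_comm]
  simp; ring

theorem hasSum_norm_adjoint_sq (h : IsSingularSystem A η w) (g : L) :
    HasSum (fun i => ⟪A (η i), g⟫_ℝ ^ 2) (‖A.adjoint g‖ ^ 2) := by
  have := h.hasSum_of_kernel (A.adjoint g) (A.adjoint g) (fun e he => by
    rw [ContinuousLinearMap.adjoint_inner_right, he, inner_zero_left])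
  rw [real_inner_self_eq_norm_sq] at this
  convert this using 2 with i
  rw [ContinuousLinearMap.adjoint_inner_left, ContinuousLinearMap.adjoint_inner_right,
    real_inner_comm]
  ring

theorem norm_image_sq (h : IsSingularSystem A η w) (i : I) : ‖A (η i)‖ ^ 2 = w i := by
  rw [norm_image_sq_eq (h.eigen i), h.orthonormal.1 i]; ring

theorem sum_le (h : IsSingularSystem A η w) {B : ℝ} (hB : HSBound A B) (s : Finset I) :
    ∑ i ∈ s, w i ≤ B := by
  have := hB _ _ (h.orthonormal.comp ((↑) : s → I) Subtype.val_injective)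
  simp only [Function.comp_apply, h.norm_image_sq] at this
  rwa [Finset.sum_coe_sort s w] at this

theorem finite_lt (h : IsSingularSystem A η w) {B : ℝ} (hB : HSBound A B) {t : ℝ} (ht : 0 < t) :
    {i | t < w i}.Finite := by
  have hs : Summable w := summable_of_sum_le (fun i => (h.pos i).le) (h.sum_le hB)
  have := hs.tendsto_cofinite_zero.eventually (gt_mem_nhds ht)
  rw [Filter.eventually_cofinite] at this
  exact this.subset fun i hi => not_lt.2 (le_of_lt hi)

/-- On the orthogonal complement of the eigenvectors with eigenvalue above `t`, the operator has
squared norm at most `t`. -/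
theorem norm_sq_le_of_inner_eq_zero (h : IsSingularSystem A η w) {t : ℝ} (ht : 0 ≤ t) {f : H}
    (hf : ∀ i, t < w i → ⟪η i, f⟫_ℝ = 0) : ‖A f‖ ^ 2 ≤ t * ‖f‖ ^ 2 := by
  have hb := h.orthonormal.inner_products_summable (x := f)
  have h1 : ‖A f‖ ^ 2 ≤ ∑' i, t * ‖⟪η i, f⟫_ℝ‖ ^ 2 := by
    rw [← (h.hasSum_norm_sq f).tsum_eq]
    refine (h.hasSum_norm_sq f).summable.tsum_le_tsum (fun i => ?_) (hb.mul_left t)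
    rw [Real.norm_eq_abs, sq_abs]
    rcases lt_or_ge t (w i) with hi | hi
    · simp [hf i hi]
    · gcongr
  refine h1.trans ?_
  rw [tsum_mul_left]
  gcongr
  exact h.orthonormal.tsum_inner_products_le f

end IsSingularSystem

/-! ### Singular numbers -/

variable {A : H →L[ℝ] L} {B : ℝ}

theorem HSBound.bddAbove (hB : HSBound A B) (j : ℕ) :
    BddAbove {m : ℝ | ∃ (η : Fin (j + 1) → H) (c : Fin (j + 1) → ℝ),
      Orthonormal ℝ η ∧ (∀ i, A.adjoint (A (η i)) = c i • η i) ∧ ∀ i, m ≤ c i} := by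
  refine ⟨B, ?_⟩
  rintro m ⟨η, c, hη, he, hm⟩
  have h := norm_image_sq_eq (he 0)
  rw [hη.1 0] at h
  have := hB.norm_image_sq_le (hη.1 0)
  linarith [hm 0]

theorem sqSingular_nonneg (A : H →L[ℝ] L) (j : ℕ) : 0 ≤ sqSingular A j := by
  rcases Set.eq_empty_or_nonempty {m : ℝ | ∃ (η : Fin (j + 1) → H) (c : Fin (j + 1) → ℝ),
      Orthonormal ℝ η ∧ (∀ i, A.adjoint (A (η i)) = c i • η i) ∧ ∀ i, m ≤ c i} with h | h
  · rw [sqSingular, h, Real.sSup_empty]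
  · obtain ⟨m, η, c, hη, he, hm⟩ := h
    refine Real.sSup_nonneg' ⟨0, ⟨η, c, hη, he, fun i => ?_⟩, le_rfl⟩
    have h := norm_image_sq_eq (he i)
    rw [hη.1 i, one_pow, mul_one] at h
    exact h ▸ sq_nonneg _

/-- Above a level below the `j`-th singular number there is a subspace of dimension `j + 1`. -/
theorem exists_subspace_of_lt_sqSingular {j : ℕ} {t : ℝ} (ht : 0 ≤ t) (h : t < sqSingular A j) :
    ∃ m, t < m ∧ ∃ V : Submodule ℝ H, Module.finrank ℝ V = j + 1 ∧
      ∀ f ∈ V, m * ‖f‖ ^ 2 ≤ ‖A f‖ ^ 2 := by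
  have hne : {m : ℝ | ∃ (η : Fin (j + 1) → H) (c : Fin (j + 1) → ℝ),
      Orthonormal ℝ η ∧ (∀ i, A.adjoint (A (η i)) = c i • η i) ∧ ∀ i, m ≤ c i}.Nonempty := by
    by_contra h0
    rw [Set.not_nonempty_iff_eq_empty] at h0
    rw [sqSingular, h0, Real.sSup_empty] at h
    linarith
  obtain ⟨m, ⟨η, c, hη, he, hm⟩, htm⟩ := exists_lt_of_lt_csSup hne h
  refine ⟨m, htm, Submodule.span ℝ (Set.range η), ?_, fun f hf => ?_⟩
  · rw [finrank_span_eq_card hη.linearIndependent, Fintype.card_fin]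
  · obtain ⟨x, rfl⟩ := (Submodule.mem_span_range_iff_exists_fun ℝ).1 hf
    have h1 : ‖A (∑ i, x i • η i)‖ ^ 2 = ∑ i, c i * x i ^ 2 := by
      rw [← real_inner_self_eq_norm_sq, ← ContinuousLinearMap.adjoint_inner_left]
      simp only [map_sum, map_smul, he, smul_smul]
      rw [hη.inner_sum]
      refine Finset.sum_congr rfl fun i _ => ?_
      simp; ring
    rw [h1, norm_sum_smul_sq hη, Finset.mul_sum]
    exact Finset.sum_le_sum fun i _ => mul_le_mul_of_nonneg_right (hm i) (sq_nonneg _)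

/-- The variant of `exists_subspace_of_lt_sqSingular` for the adjoint operator. -/
theorem exists_subspace_adjoint_of_lt_sqSingular {j : ℕ} {t : ℝ} (ht : 0 ≤ t)
    (h : t < sqSingular A j) :
    ∃ m, t < m ∧ ∃ V : Submodule ℝ L, Module.finrank ℝ V = j + 1 ∧
      ∀ g ∈ V, m * ‖g‖ ^ 2 ≤ ‖A.adjoint g‖ ^ 2 := by
  obtain ⟨m, htm, V, hV, hA⟩ := exists_subspace_of_lt_sqSingular ht h
  have hm : 0 < m := ht.trans_lt htm
  refine ⟨m, htm, V.map (A : H →ₗ[ℝ] L), ?_, ?_⟩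
  · rw [← hV]
    have hrange : V.map (A : H →ₗ[ℝ] L) = LinearMap.range ((A : H →ₗ[ℝ] L).comp V.subtype) := by
      rw [LinearMap.range_comp, Submodule.range_subtype]
    rw [hrange]
    refine LinearMap.finrank_range_of_inj ((injective_iff_map_eq_zero _).2 fun f hf => ?_)
    have h1 := hA f f.2
    have h2 : A (f : H) = 0 := hf
    rw [h2, norm_zero] at h1
    have h3 : ‖(f : H)‖ ^ 2 = 0 := by nlinarith [sq_nonneg ‖(f : H)‖]
    exact Subtype.ext (by simpa using h3)
  · rintro _ ⟨f, hf, rfl⟩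
    have h1 := hA f hf
    change m * ‖A f‖ ^ 2 ≤ ‖A.adjoint (A f)‖ ^ 2
    have h2 : ‖A f‖ ^ 2 ≤ ‖A.adjoint (A f)‖ * ‖f‖ := by
      rw [← real_inner_self_eq_norm_sq, ← ContinuousLinearMap.adjoint_inner_left]
      exact real_inner_le_norm _ _
    rcases eq_or_ne (‖A f‖ ^ 2) 0 with h0 | h0
    · rw [h0, mul_zero]; positivity
    have h3 : 0 < ‖A f‖ ^ 2 := lt_of_le_of_ne (sq_nonneg _) h0.symm
    refine le_of_mul_le_mul_right ?_ h3
    calc m * ‖A f‖ ^ 2 * ‖A f‖ ^ 2 = m * (‖A f‖ ^ 2) ^ 2 := by ring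
      _ ≤ m * (‖A.adjoint (A f)‖ * ‖f‖) ^ 2 := by gcongr
      _ = ‖A.adjoint (A f)‖ ^ 2 * (m * ‖f‖ ^ 2) := by ring
      _ ≤ _ := by gcongr

theorem exists_finset_of_encard_lt {I : Type} {w : I → ℝ} {j : ℕ} {t : ℝ}
    (hj : {i | t < w i}.encard < (j + 1 : ℕ)) :
    ∃ s : Finset I, s.card ≤ j ∧ ∀ i, t < w i → i ∈ s := by
  have hfin : {i | t < w i}.Finite := Set.finite_of_encard_le_coe hj.le
  refine ⟨hfin.toFinset, ?_, fun i hi => by simpa using hi⟩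
  rw [hfin.encard_eq_coe_toFinset_card] at hj
  have := Nat.cast_lt.1 hj
  omega

/-- The numbers `sqSingular A j` are the numbers `w i`, sorted. -/
theorem IsSingularSystem.lt_sqSingular_iff {I : Type} {η : I → H} {w : I → ℝ}
    (h : IsSingularSystem A η w) (hB : HSBound A B) {j : ℕ} {t : ℝ} (ht : 0 ≤ t) :
    t < sqSingular A j ↔ ((j + 1 : ℕ) : ℕ∞) ≤ {i | t < w i}.encard := by
  constructor
  · intro hlt
    by_contra! hcon
    obtain ⟨s, hs, hmem⟩ := exists_finset_of_encard_lt hcon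
    obtain ⟨m, htm, V, hV, hA⟩ := exists_subspace_of_lt_sqSingular ht hlt
    obtain ⟨f, hfV, hf0, hf⟩ := exists_ne_zero_of_card_lt_finrank
      (fun i : s => (innerSL ℝ (η i) : H →ₗ[ℝ] ℝ)) V (by rw [hV, Fintype.card_coe]; omega)
    have h1 := h.norm_sq_le_of_inner_eq_zero ht (f := f) fun i hi => by
      simpa using hf ⟨i, hmem i hi⟩
    have h2 := hA f hfV
    have h3 : 0 < ‖f‖ ^ 2 := by positivity
    nlinarith
  · intro hle
    obtain ⟨s, hs, hcard⟩ := Set.exists_subset_encard_eq hle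
    have hfin : s.Finite := Set.finite_of_encard_eq_coe hcard
    have hc : hfin.toFinset.card = j + 1 := by
      rw [hfin.encard_eq_coe_toFinset_card] at hcard
      exact_mod_cast hcard
    set e := hfin.toFinset.equivFinOfCardEq hc
    obtain ⟨k, -, hk⟩ := Finset.exists_min_image Finset.univ
      (fun i => w (e.symm i)) ⟨(0 : Fin (j + 1)), Finset.mem_univ _⟩
    have hlt : t < w (e.symm k) := hs (hfin.mem_toFinset.1 (e.symm k).2)
    refine hlt.trans_le (le_csSup (hB.bddAbove j) ⟨fun i => η (e.symm i), fun i => w (e.symm i),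
      h.orthonormal.comp _ (Subtype.val_injective.comp e.symm.injective),
      fun i => h.eigen _, fun i => hk i (Finset.mem_univ _)⟩)

theorem HSBound.antitone_sqSingular (hB : HSBound A B) : Antitone (sqSingular A) := by
  obtain ⟨I, η, w, h⟩ := hB.exists_isSingularSystem
  intro i j hij
  refine le_of_forall_lt fun t ht => ?_
  rcases lt_or_ge t 0 with h0 | h0
  · exact h0.trans_le (sqSingular_nonneg A i)
  · rw [h.lt_sqSingular_iff hB h0] at ht ⊢
    refine le_trans ?_ ht
    exact_mod_cast Nat.succ_le_succ hij

theorem IsSingularSystem.encard_lt_sqSingular {I : Type} {η : I → H} {w : I → ℝ}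
    (h : IsSingularSystem A η w) (hB : HSBound A B) {t : ℝ} (ht : 0 < t) :
    {j | t < sqSingular A j}.encard = {i | t < w i}.encard := by
  have hfin := h.finite_lt hB ht
  have : {j | t < sqSingular A j} = (Finset.range hfin.toFinset.card : Set ℕ) := by
    ext j
    rw [Set.mem_ofPred_eq, h.lt_sqSingular_iff hB ht.le, hfin.encard_eq_coe_toFinset_card,
      Nat.cast_le, Finset.coe_range, Set.mem_Iio, Nat.succ_le_iff]
  rw [this, Set.encard_coe_eq_coe_finsetCard, Finset.card_range, hfin.encard_eq_coe_toFinset_card]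

/-- Power sums are given by the counting function (the layer cake formula). -/
theorem tsum_rpow_eq_lintegral {I : Type} {w : I → ℝ} (hw : ∀ i, 0 ≤ w i) {s : ℝ} (hs : 0 < s) :
    ∑' i, ENNReal.ofReal (w i ^ s) = ENNReal.ofReal s *
      ∫⁻ t in Set.Ioi 0, ({i | t < w i}.encard : ℝ≥0∞) * ENNReal.ofReal (t ^ (s - 1)) := by
  let _ : MeasurableSpace I := ⊤
  have := lintegral_rpow_eq_lintegral_meas_lt_mul (Measure.count : Measure I) (f := w)
    (Filter.Eventually.of_forall hw) (measurable_from_top.aemeasurable) hs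
  rw [lintegral_count] at this
  rw [this]
  simp only [Measure.count_apply (MeasurableSpace.measurableSet_top)]

theorem IsSingularSystem.tsum_sqSingular_rpow {I : Type} {η : I → H} {w : I → ℝ}
    (h : IsSingularSystem A η w) (hB : HSBound A B) {s : ℝ} (hs : 0 < s) :
    ∑' j, ENNReal.ofReal (sqSingular A j ^ s) = ∑' i, ENNReal.ofReal (w i ^ s) := by
  rw [tsum_rpow_eq_lintegral (sqSingular_nonneg A) hs,
    tsum_rpow_eq_lintegral (fun i => (h.pos i).le) hs]
  congr 1
  refine setLIntegral_congr_fun measurableSet_Ioi fun t ht => ?_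
  simp only [h.encard_lt_sqSingular hB ht]

/-- The variant of `norm_sq_le_of_inner_eq_zero` for the adjoint operator. -/
theorem IsSingularSystem.norm_adjoint_sq_le {I : Type} {η : I → H} {w : I → ℝ}
    (h : IsSingularSystem A η w) {t : ℝ} (ht : 0 ≤ t) {g : L}
    (hg : ∀ i, t < w i → ⟪A (η i), g⟫_ℝ = 0) : ‖A.adjoint g‖ ^ 2 ≤ t * ‖g‖ ^ 2 := by
  have h1 := h.norm_sq_le_of_inner_eq_zero ht (f := A.adjoint g) fun i hi => by
    rw [ContinuousLinearMap.adjoint_inner_right, hg i hi]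
  have h2 : ‖A.adjoint g‖ ^ 2 ≤ ‖A (A.adjoint g)‖ * ‖g‖ := by
    rw [← real_inner_self_eq_norm_sq, ContinuousLinearMap.adjoint_inner_right]
    exact real_inner_le_norm _ _
  rcases eq_or_ne (‖A.adjoint g‖ ^ 2) 0 with h0 | h0
  · rw [h0]; positivity
  have h3 : 0 < ‖A.adjoint g‖ ^ 2 := lt_of_le_of_ne (sq_nonneg _) h0.symm
  refine le_of_mul_le_mul_right ?_ h3
  calc ‖A.adjoint g‖ ^ 2 * ‖A.adjoint g‖ ^ 2 = (‖A.adjoint g‖ ^ 2) ^ 2 := by ring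
    _ ≤ (‖A (A.adjoint g)‖ * ‖g‖) ^ 2 := by gcongr
    _ = ‖A (A.adjoint g)‖ ^ 2 * ‖g‖ ^ 2 := by ring
    _ ≤ (t * ‖A.adjoint g‖ ^ 2) * ‖g‖ ^ 2 := by gcongr
    _ = _ := by ring

/-- The trace of `A A†` in an arbitrary Hilbert basis. -/
theorem IsSingularSystem.tsum_norm_adjoint_sq {I : Type} {η : I → H} {w : I → ℝ}
    (h : IsSingularSystem A η w) {κ : Type} (b : HilbertBasis κ ℝ L) :
    ∑' k, ENNReal.ofReal (‖A.adjoint (b k)‖ ^ 2) = ∑' i, ENNReal.ofReal (w i) := by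
  have h1 : ∀ k, ENNReal.ofReal (‖A.adjoint (b k)‖ ^ 2) =
      ∑' i, ENNReal.ofReal (⟪A (η i), b k⟫_ℝ ^ 2) := fun k => by
    rw [← (h.hasSum_norm_adjoint_sq (b k)).tsum_eq]
    exact ENNReal.ofReal_tsum_of_nonneg (fun _ => sq_nonneg _)
      (h.hasSum_norm_adjoint_sq (b k)).summable
  simp_rw [h1]
  rw [ENNReal.tsum_comm]
  refine tsum_congr fun i => ?_
  have h2 := b.hasSum_inner_mul_inner (A (η i)) (A (η i))
  rw [real_inner_self_eq_norm_sq, h.norm_image_sq] at h2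
  have h3 : (fun k => ⟪A (η i), b k⟫_ℝ * ⟪b k, A (η i)⟫_ℝ) = fun k => ⟪A (η i), b k⟫_ℝ ^ 2 := by
    ext k; rw [real_inner_comm (A (η i)) (b k)]; ring
  rw [h3] at h2
  rw [← h2.tsum_eq]
  exact (ENNReal.ofReal_tsum_of_nonneg (fun _ => sq_nonneg _) h2.summable).symm

section Comparison

/-! ### Rank one perturbations: `A' A'† = a ⟪u, ·⟫ u + b A A†` -/

variable {H' : Type} [NormedAddCommGroup H'] [InnerProductSpace ℝ H'] [CompleteSpace H']
  {A' : H' →L[ℝ] L} {B' : ℝ} {u : L} {a b : ℝ}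

/-- A perturbation of rank one shifts the singular numbers by at most one index. -/
theorem sqSingular_succ_le_of_rank_one (hB : HSBound A B) (hb : 0 ≤ b)
    (hq : ∀ g, ‖A'.adjoint g‖ ^ 2 = a * ⟪u, g⟫_ℝ ^ 2 + b * ‖A.adjoint g‖ ^ 2) (j : ℕ) :
    sqSingular A' (j + 1) ≤ b * sqSingular A j := by
  obtain ⟨I, η, w, h⟩ := hB.exists_isSingularSystem
  have h0 := sqSingular_nonneg A j
  by_contra! hcon
  obtain ⟨m, htm, V, hV, hA⟩ := exists_subspace_adjoint_of_lt_sqSingular (mul_nonneg hb h0) hcon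
  obtain ⟨s, hs, hmem⟩ := exists_finset_of_encard_lt (w := w) (j := j) (t := sqSingular A j)
    (not_le.1 fun hh => lt_irrefl _ ((h.lt_sqSingular_iff hB h0).2 hh))
  obtain ⟨g, hgV, hg0, hg⟩ := exists_ne_zero_of_card_lt_finrank
    (fun o : Option s => (innerSL ℝ (o.elim u fun i => A (η i)) : L →ₗ[ℝ] ℝ)) V (by
      rw [hV, Fintype.card_option, Fintype.card_coe]; omega)
  have h1 := h.norm_adjoint_sq_le h0 (g := g) fun i hi => by
    simpa using hg (some ⟨i, hmem i hi⟩)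
  have h2 : ⟪u, g⟫_ℝ = 0 := by simpa using hg none
  have h3 := hA g hgV
  rw [hq, h2] at h3
  have h4 : 0 < ‖g‖ ^ 2 := by positivity
  nlinarith

/-- Adding a positive operator of rank one does not decrease the singular numbers. -/
theorem mul_sqSingular_le_of_rank_one (hB' : HSBound A' B') (ha : 0 ≤ a) (hb : 0 ≤ b)
    (hq : ∀ g, ‖A'.adjoint g‖ ^ 2 = a * ⟪u, g⟫_ℝ ^ 2 + b * ‖A.adjoint g‖ ^ 2) (j : ℕ) :
    b * sqSingular A j ≤ sqSingular A' j := by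
  obtain ⟨I, η, w, h⟩ := hB'.exists_isSingularSystem
  have h0 := sqSingular_nonneg A' j
  by_contra! hcon
  have hb' : 0 < b := by
    rcases hb.eq_or_lt with rfl | hb'
    · linarith
    · exact hb'
  have hlt : sqSingular A' j / b < sqSingular A j := by rwa [div_lt_iff₀' hb']
  obtain ⟨m, htm, V, hV, hA⟩ := exists_subspace_adjoint_of_lt_sqSingular (div_nonneg h0 hb) hlt
  rw [div_lt_iff₀' hb'] at htm
  obtain ⟨s, hs, hmem⟩ := exists_finset_of_encard_lt (w := w) (j := j) (t := sqSingular A' j)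
    (not_le.1 fun hh => lt_irrefl _ ((h.lt_sqSingular_iff hB' h0).2 hh))
  obtain ⟨g, hgV, hg0, hg⟩ := exists_ne_zero_of_card_lt_finrank
    (fun i : s => (innerSL ℝ (A' (η i)) : L →ₗ[ℝ] ℝ)) V (by rw [hV, Fintype.card_coe]; omega)
  have h1 := h.norm_adjoint_sq_le h0 (g := g) fun i hi => by
    simpa using hg ⟨i, hmem i hi⟩
  have h3 := hA g hgV
  rw [hq] at h1
  have h4 : 0 < ‖g‖ ^ 2 := by positivity
  have h5 : 0 ≤ a * ⟪u, g⟫_ℝ ^ 2 := by positivity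
  nlinarith [mul_le_mul_of_nonneg_left h3 hb]

theorem norm_adjoint_sq_le_sqSingular_zero (hB : HSBound A B) (g : L) :
    ‖A.adjoint g‖ ^ 2 ≤ sqSingular A 0 * ‖g‖ ^ 2 := by
  obtain ⟨I, η, w, h⟩ := hB.exists_isSingularSystem
  have h0 := sqSingular_nonneg A 0
  obtain ⟨s, hs, hmem⟩ := exists_finset_of_encard_lt (w := w) (j := 0) (t := sqSingular A 0)
    (not_le.1 fun hh => lt_irrefl _ ((h.lt_sqSingular_iff hB h0).2 hh))
  refine h.norm_adjoint_sq_le h0 fun i hi => ?_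
  have := hmem i hi
  rw [Finset.card_eq_zero.1 (Nat.le_zero.1 hs)] at this
  simp at this

/-- Traces are additive. -/
theorem tsum_sqSingular_of_rank_one (hB : HSBound A B) (hB' : HSBound A' B') (ha : 0 ≤ a)
    (hb : 0 ≤ b) (hq : ∀ g, ‖A'.adjoint g‖ ^ 2 = a * ⟪u, g⟫_ℝ ^ 2 + b * ‖A.adjoint g‖ ^ 2) :
    ∑' j, ENNReal.ofReal (sqSingular A' j) =
      ENNReal.ofReal (a * ‖u‖ ^ 2) + ENNReal.ofReal b * ∑' j, ENNReal.ofReal (sqSingular A j) := by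
  obtain ⟨I, η, w, h⟩ := hB.exists_isSingularSystem
  obtain ⟨I', η', w', h'⟩ := hB'.exists_isSingularSystem
  obtain ⟨κ, e, he⟩ := exists_hilbertBasis ℝ L
  have h1 := h.tsum_sqSingular_rpow hB one_pos
  have h1' := h'.tsum_sqSingular_rpow hB' one_pos
  simp only [Real.rpow_one] at h1 h1'
  rw [h1, h1', ← h.tsum_norm_adjoint_sq e, ← h'.tsum_norm_adjoint_sq e]
  have h2 := e.hasSum_inner_mul_inner u u
  rw [real_inner_self_eq_norm_sq] at h2
  have h3 : (fun k => ⟪u, e k⟫_ℝ * ⟪e k, u⟫_ℝ) = fun k => ⟪u, e k⟫_ℝ ^ 2 := by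
    ext k; rw [real_inner_comm u (e k)]; ring
  rw [h3] at h2
  rw [← h2.tsum_eq, ENNReal.ofReal_mul ha,
    ENNReal.ofReal_tsum_of_nonneg (fun _ => sq_nonneg _) h2.summable, ← ENNReal.tsum_mul_left,
    ← ENNReal.tsum_mul_left, ← ENNReal.tsum_add]
  refine tsum_congr fun k => ?_
  rw [hq, ENNReal.ofReal_add (by positivity) (by positivity), ENNReal.ofReal_mul ha,
    ENNReal.ofReal_mul hb]

end Comparison

end Hilbert

/-! ### The embedding of a reproducing kernel Hilbert space into `L₂` -/

section Embedding

variable {X : Type}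

theorem PDKernel.symm (K : PDKernel X) (x y : X) : K x y = K y x := by
  simpa using (K.posSemidef.isHermitian.apply x y).symm

/-- The function `K(·,x)` as an element of the reproducing kernel Hilbert space. -/
noncomputable def PDKernel.sectionAt (K : PDKernel X) (x : X) : K.space := RKHS.kerFun K.space x 1

theorem PDKernel.inner_section (K : PDKernel X) (x : X) (f : K.space) :
    ⟪K.sectionAt x, f⟫_ℝ = f x := by
  rw [PDKernel.sectionAt, RKHS.kerFun_inner]
  simp

theorem PDKernel.section_apply (K : PDKernel X) (x y : X) : K.sectionAt x y = K y x := by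
  rw [PDKernel.sectionAt, RKHS.kerFun_apply, K.kernel_space]

theorem PDKernel.norm_section_sq (K : PDKernel X) (x : X) : ‖K.sectionAt x‖ ^ 2 = K x x := by
  rw [← real_inner_self_eq_norm_sq, K.inner_section, K.section_apply]

theorem PDKernel.apply_sq_le (K : PDKernel X) (f : K.space) (x : X) :
    f x ^ 2 ≤ ‖f‖ ^ 2 * K x x := by
  rw [← K.inner_section, ← K.norm_section_sq, ← mul_pow, mul_comm]
  exact sq_le_sq' (neg_le_of_abs_le (abs_real_inner_le_norm _ _)) (real_inner_le_norm _ _)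

variable [MeasurableSpace X]

/-- The kernel is jointly measurable and has an integrable diagonal, so that its reproducing kernel
Hilbert space consists of square integrable functions. -/
structure Admissible (K : PDKernel X) (μ : Measure X) : Prop where
  meas : Measurable fun z : X × X => K z.1 z.2
  int : Integrable (fun t => K t t) μ

variable {K : PDKernel X} {μ : Measure X}

theorem Admissible.measurable (h : Admissible K μ) (f : K.space) : Measurable f := by
  have hmem : f ∈ (Submodule.span ℝ {RKHS.kerFun K.space x v | (x) (v)}).topologicalClosure := by
    rw [RKHS.kerFun_dense]; trivial
  rw [← SetLike.mem_coe, Submodule.topologicalClosure_coe, mem_closure_iff_seq_limit] at hmem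
  obtain ⟨u, hu, hlim⟩ := hmem
  have hspan : ∀ g ∈ Submodule.span ℝ {RKHS.kerFun K.space x v | (x) (v)}, Measurable g := by
    intro g hg
    induction hg using Submodule.span_induction with
    | mem g hg =>
      obtain ⟨x, v, rfl⟩ := hg
      have : ⇑(RKHS.kerFun K.space x v) = fun y => v * K y x := by
        ext y
        have : (v : ℝ) = v • (1 : ℝ) := by simp
        rw [this, map_smul, RKHS.coe_smul, Pi.smul_apply, ← PDKernel.sectionAt, K.section_apply]
        simp
      rw [this]
      exact (h.meas.comp measurable_prodMk_right).const_mul v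
    | zero => rw [RKHS.coe_zero]; exact measurable_zero
    | add a b _ _ ha hb => rw [RKHS.coe_add]; exact ha.add hb
    | smul c a _ ha => rw [RKHS.coe_smul]; exact ha.const_smul c
  refine measurable_of_tendsto_metrizable (fun n => hspan _ (hu n)) (tendsto_pi_nhds.2 fun x => ?_)
  exact ((RKHS.continuous_eval (H := K.space) x).tendsto f).comp hlim

theorem Admissible.memLp (h : Admissible K μ) (f : K.space) : MemLp f 2 μ := by
  rw [memLp_two_iff_integrable_sq (h.measurable f).aestronglyMeasurable]
  refine (h.int.const_mul (‖f‖ ^ 2)).mono' ((h.measurable f).pow_const 2).aestronglyMeasurable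
    (Filter.Eventually.of_forall fun x => ?_)
  rw [Real.norm_eq_abs, abs_of_nonneg (sq_nonneg _)]
  exact K.apply_sq_le f x

theorem norm_toLp_sq {f : X → ℝ} (hf : MemLp f 2 μ) : ‖hf.toLp f‖ ^ 2 = ∫ x, f x ^ 2 ∂μ := by
  rw [← real_inner_self_eq_norm_sq, L2.inner_def]
  refine integral_congr_ae ?_
  filter_upwards [hf.coeFn_toLp] with x hx
  rw [hx]; simp [sq]

theorem Admissible.norm_toLp_le (h : Admissible K μ) (f : K.space) :
    ‖(h.memLp f).toLp f‖ ≤ √(∫ t, K t t ∂μ) * ‖f‖ := by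
  refine abs_le_of_sq_le_sq' ?_ (by positivity) |>.2
  have h0 : 0 ≤ ∫ t, K t t ∂μ := integral_nonneg fun t => by
    rw [← K.norm_section_sq]; exact sq_nonneg _
  rw [norm_toLp_sq, mul_pow, Real.sq_sqrt h0, mul_comm, ← integral_const_mul]
  refine integral_mono (h.memLp f).integrable_sq (h.int.const_mul _) fun x => K.apply_sq_le f x

/-- The embedding of the reproducing kernel Hilbert space into `L₂(μ)`. -/
noncomputable def Admissible.embed (h : Admissible K μ) : K.space →L[ℝ] Lp ℝ 2 μ :=
  LinearMap.mkContinuous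
    { toFun := fun f => (h.memLp f).toLp f
      map_add' := fun f g => by
        rw [← MemLp.toLp_add]; congr 1; exact RKHS.coe_add f g
      map_smul' := fun c f => by
        rw [RingHom.id_apply, ← MemLp.toLp_const_smul]; congr 1; exact RKHS.coe_smul f c }
    (√(∫ t, K t t ∂μ)) h.norm_toLp_le

theorem Admissible.embed_apply (h : Admissible K μ) (f : K.space) :
    h.embed f = (h.memLp f).toLp f := rfl

theorem Admissible.coeFn_embed (h : Admissible K μ) (f : K.space) : h.embed f =ᵐ[μ] f :=
  (h.memLp f).coeFn_toLp

theorem Admissible.norm_embed_sq (h : Admissible K μ) (f : K.space) :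
    ‖h.embed f‖ ^ 2 = ∫ x, f x ^ 2 ∂μ := norm_toLp_sq (h.memLp f)

theorem Admissible.inner_embed (h : Admissible K μ) (f : K.space) (g : Lp ℝ 2 μ) :
    ⟪h.embed f, g⟫_ℝ = ∫ x, f x * g x ∂μ := by
  rw [L2.inner_def]
  refine integral_congr_ae ?_
  filter_upwards [h.coeFn_embed f] with x hx
  rw [hx]; simp [mul_comm]

theorem Admissible.adjoint_apply (h : Admissible K μ) (g : Lp ℝ 2 μ) (x : X) :
    h.embed.adjoint g x = ∫ t, g t * K t x ∂μ := by
  rw [← K.inner_section, ContinuousLinearMap.adjoint_inner_right, h.inner_embed]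
  simp only [K.section_apply, mul_comm]

theorem Admissible.adjoint_embed_apply (h : Admissible K μ) (f : K.space) (x : X) :
    h.embed.adjoint (h.embed f) x = ∫ t, f t * K x t ∂μ := by
  rw [h.adjoint_apply]
  refine integral_congr_ae ?_
  filter_upwards [h.coeFn_embed f] with t ht
  rw [ht, K.symm]

theorem Admissible.isEigen_iff (h : Admissible K μ) (m : ℝ) (f : K.space) :
    IsEigen K μ m f ↔ h.embed.adjoint (h.embed f) = m • f := by
  constructor
  · intro hf
    refine RKHS.ext fun x => ?_
    rw [h.adjoint_embed_apply, hf x, RKHS.coe_smul]; rfl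
  · intro hf x
    rw [← h.adjoint_embed_apply, hf, RKHS.coe_smul]; rfl

theorem Admissible.eigenvalue_eq (h : Admissible K μ) (j : ℕ) :
    eigenvalue K μ j = sqSingular h.embed j := by
  simp only [eigenvalue, sqSingular, h.isEigen_iff]

theorem Admissible.hsBound (h : Admissible K μ) : HSBound h.embed (∫ t, K t t ∂μ) := by
  intro κ _ e he
  simp only [h.norm_embed_sq]
  rw [← integral_finsetSum _ fun i _ => (h.memLp (e i)).integrable_sq]
  refine integral_mono (integrable_finsetSum _ fun i _ => (h.memLp (e i)).integrable_sq) h.int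
    fun x => ?_
  have := he.sum_inner_products_le (K.sectionAt x) (s := Finset.univ)
  rw [K.norm_section_sq] at this
  refine le_trans (le_of_eq (Finset.sum_congr rfl fun i _ => ?_)) this
  rw [real_inner_comm, K.inner_section, Real.norm_eq_abs, sq_abs]

theorem Admissible.norm_adjoint_sq (h : Admissible K μ) (g : Lp ℝ 2 μ) :
    ‖h.embed.adjoint g‖ ^ 2 = ∫ x, h.embed.adjoint g x * g x ∂μ := by
  rw [← real_inner_self_eq_norm_sq, ContinuousLinearMap.adjoint_inner_right, h.inner_embed]

theorem Admissible.integrable_mul_kernel (h : Admissible K μ) {g : X → ℝ} (hg : MemLp g 2 μ)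
    (x : X) : Integrable (fun t => g t * K t x) μ := by
  have := (hg.integrable_mul (h.memLp (K.sectionAt x)))
  simpa only [Pi.mul_def, K.section_apply] using this

theorem Admissible.eigenvalue_nonneg (h : Admissible K μ) (j : ℕ) : 0 ≤ eigenvalue K μ j := by
  rw [h.eigenvalue_eq]; exact sqSingular_nonneg _ _

theorem Admissible.antitone_eigenvalue (h : Admissible K μ) : Antitone (eigenvalue K μ) := by
  intro i j hij
  rw [h.eigenvalue_eq, h.eigenvalue_eq]
  exact h.hsBound.antitone_sqSingular hij

/-! ### Minimal errors as singular numbers -/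

theorem eLpNorm_two_eq (f : Lp ℝ 2 μ) : eLpNorm f 2 μ = ENNReal.ofReal ‖f‖ := by
  rw [Lp.norm_def, ENNReal.ofReal_toReal (Lp.eLpNorm_ne_top f)]

theorem Admissible.minError_le (h : Admissible K μ) (n : ℕ) :
    minError K μ n ≤ ENNReal.ofReal √(eigenvalue K μ n) := by
  obtain ⟨I, η, w, hs⟩ := h.hsBound.exists_isSingularSystem
  rw [h.eigenvalue_eq]
  set t := sqSingular h.embed n with ht
  have h0 : 0 ≤ t := sqSingular_nonneg _ n
  obtain ⟨s, hcard, hmem⟩ := exists_finset_of_encard_lt (w := w) (j := n) (t := t)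
    (not_le.1 fun hh => lt_irrefl _ ((hs.lt_sqSingular_iff h.hsBound h0).2 hh))
  -- the algorithm is the orthogonal projection onto the eigenvectors of large eigenvalue, with
  -- the list of eigenvectors padded by zeros to have length `n`
  obtain ⟨e, he⟩ : ∃ e : Fin n → K.space, ∀ f,
      ∑ j, ⟪e j, f⟫_ℝ • e j = ∑ i ∈ s, ⟪η i, f⟫_ℝ • η i := by
    let φ : Fin s.card ≃ s := s.equivFin.symm
    refine ⟨fun j => if hj : j.1 < s.card then η (φ ⟨j, hj⟩) else 0, fun f => ?_⟩
    obtain ⟨m, rfl⟩ := Nat.exists_eq_add_of_le hcard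
    rw [Fin.sum_univ_add]
    simp only [Fin.val_castAdd, Fin.is_lt, dite_true, Fin.val_natAdd, Fin.eta]
    simp only [show ∀ i : Fin m, ¬ (s.card + i.1 < s.card) from fun i => by omega, dite_false,
      smul_zero, Finset.sum_const_zero, add_zero]
    rw [Equiv.sum_comp φ (fun i : s => ⟪η i, f⟫_ℝ • η i),
      Finset.sum_coe_sort s (fun i => ⟪η i, f⟫_ℝ • η i)]
  refine iInf_le_of_le (fun j => innerSL ℝ (e j)) (iInf_le_of_le (fun j => ⇑(e j))
    (iInf_le_of_le (fun j => h.memLp _) ?_))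
  refine iSup₂_le fun f hf => ?_
  set f' := f - ∑ i ∈ s, ⟪η i, f⟫_ℝ • η i with hf'
  have h1 : (fun x => f x - ∑ j, (innerSL ℝ (e j)) f * e j x) = f' := by
    ext x
    rw [hf', ← he, ← K.inner_section x (f - _), inner_sub_right, inner_sum]
    simp only [K.inner_section, innerSL_apply_apply, RKHS.coe_smul, Pi.smul_apply, smul_eq_mul]
  rw [h1, ← eLpNorm_congr_ae (h.coeFn_embed f'), eLpNorm_two_eq]
  refine ENNReal.ofReal_le_ofReal (Real.le_sqrt_of_sq_le ?_)
  classical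
  refine (hs.norm_sq_le_of_inner_eq_zero h0 (f := f') fun i hi => ?_).trans ?_
  · rw [hf', inner_sub_sum_eq hs.orthonormal, if_pos (hmem i hi)]
  · have h2 := norm_sub_sum_sq hs.orthonormal s f
    have h3 : ‖f‖ ^ 2 ≤ 1 := pow_le_one₀ (norm_nonneg _) hf
    nlinarith

theorem Admissible.le_minError (h : Admissible K μ) (n : ℕ) :
    ENNReal.ofReal √(eigenvalue K μ n) ≤ minError K μ n := by
  refine le_iInf fun L => le_iInf fun a => le_iInf fun ha => ?_
  rw [h.eigenvalue_eq]
  refine le_of_forall_lt fun y hy => ?_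
  obtain ⟨r, hr0, hyr, hr⟩ : ∃ r : ℝ, 0 ≤ r ∧ y = ENNReal.ofReal r ∧
      r ^ 2 < sqSingular h.embed n := by
    have hy' : y ≠ ∞ := ne_top_of_lt hy
    refine ⟨y.toReal, ENNReal.toReal_nonneg, (ENNReal.ofReal_toReal hy').symm, ?_⟩
    rw [ENNReal.lt_ofReal_iff_toReal_lt hy'] at hy
    exact (Real.lt_sqrt ENNReal.toReal_nonneg).1 hy
  obtain ⟨m, hm, V, hV, hA⟩ := exists_subspace_of_lt_sqSingular (sq_nonneg r) hr
  obtain ⟨f, hfV, hf0, hf⟩ := exists_ne_zero_of_card_lt_finrank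
    (fun i => (L i : K.space →ₗ[ℝ] ℝ)) V (by rw [hV, Fintype.card_fin]; omega)
  have hn : ‖f‖ ≠ 0 := norm_ne_zero_iff.2 hf0
  set f' := ‖f‖⁻¹ • f with hf'
  have hn' : ‖f'‖ = 1 := by rw [hf', norm_smul, norm_inv, norm_norm, inv_mul_cancel₀ hn]
  refine lt_of_lt_of_le ?_ (le_iSup₂_of_le f' hn'.le le_rfl)
  have h1 : (fun x => f' x - ∑ j, L j f' * a j x) = f' := by
    ext x
    have : ∀ j, L j f' = 0 := fun j => by
      rw [hf', map_smul, show L j f = 0 from hf j, smul_zero]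
    simp [this]
  rw [h1, ← eLpNorm_congr_ae (h.coeFn_embed f'), eLpNorm_two_eq, hyr]
  have h2 := hA f' (V.smul_mem _ hfV)
  rw [hn', one_pow, mul_one] at h2
  exact (ENNReal.ofReal_lt_ofReal_iff_of_nonneg hr0).2
    (lt_of_pow_lt_pow_left₀ 2 (norm_nonneg _) (hm.trans_le h2))

/-- The `n`-th minimal worst case error is the square root of the `n`-th eigenvalue. -/
theorem Admissible.minError_eq (h : Admissible K μ) (n : ℕ) :
    minError K μ n = ENNReal.ofReal √(eigenvalue K μ n) :=
  le_antisymm (h.minError_le n) (h.le_minError n)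

end Embedding

/-! ### Sums of families of nonnegative numbers -/

theorem hasSum_of_tsum_ofReal {I : Type} {w : I → ℝ} (hw : ∀ i, 0 ≤ w i) {B : ℝ} (hB : 0 ≤ B)
    (h : ∑' i, ENNReal.ofReal (w i) = ENNReal.ofReal B) : HasSum w B := by
  have hne : ∑' i, ENNReal.ofReal (w i) ≠ ∞ := by rw [h]; exact ENNReal.ofReal_ne_top
  have h1 := ENNReal.hasSum_toReal hne
  rw [← ENNReal.tsum_toReal_eq (fun i => ENNReal.ofReal_ne_top), h, ENNReal.toReal_ofReal hB] at h1
  simpa only [ENNReal.toReal_ofReal (hw _)] using h1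

theorem tsum_ofReal_of_hasSum {I : Type} {w : I → ℝ} (hw : ∀ i, 0 ≤ w i) {B : ℝ}
    (h : HasSum w B) : ∑' i, ENNReal.ofReal (w i) = ENNReal.ofReal B := by
  rw [← h.tsum_eq, ENNReal.ofReal_tsum_of_nonneg hw h.summable]

theorem tsum_pi_prod : ∀ {d : ℕ} {I : Fin d → Type} (f : ∀ l, I l → ℝ≥0∞),
    ∑' J : ∀ l, I l, ∏ l, f l (J l) = ∏ l, ∑' i, f l i
  | 0, I, f => by simp
  | d + 1, I, f => by
    rw [← (Fin.consEquiv I).tsum_eq, ENNReal.tsum_prod', Fin.prod_univ_succ,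
      ← tsum_pi_prod (fun l => f l.succ), ← ENNReal.tsum_mul_right]
    refine tsum_congr fun i => ?_
    rw [← ENNReal.tsum_mul_left]
    refine tsum_congr fun J => ?_
    rw [Fin.prod_univ_succ]
    simp [Fin.consEquiv]

/-! ### The kernel `1 - a² + a² K` -/

section Hat

variable {X : Type}

theorem hatKernel_apply (a : unitInterval) (K : PDKernel X) (x t : X) :
    hatKernel a K x t = 1 - (a : ℝ) ^ 2 + (a : ℝ) ^ 2 * K x t := rfl

variable [MeasurableSpace X] {K : PDKernel X} {μ : Measure X} [IsProbabilityMeasure μ]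

theorem Admissible.hat (h : Admissible K μ) (a : unitInterval) :
    Admissible (hatKernel a K) μ where
  meas := (h.meas.const_mul _).const_add _
  int := (integrable_const _).add (h.int.const_mul _)

theorem Admissible.integral_hat_diag (h : Admissible K μ) (hK : ∫ t, K t t ∂μ = 1)
    (a : unitInterval) : ∫ t, hatKernel a K t t ∂μ = 1 := by
  simp only [hatKernel_apply]
  rw [integral_add (integrable_const _) (h.int.const_mul _), integral_const_mul, hK]
  simp

/-- The constant function `1` in `L₂(μ)`. -/
noncomputable def constOne (μ : Measure X) [IsProbabilityMeasure μ] : Lp ℝ 2 μ :=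
  (memLp_const (1 : ℝ)).toLp _

theorem inner_constOne (g : Lp ℝ 2 μ) : ⟪constOne μ, g⟫_ℝ = ∫ x, g x ∂μ := by
  rw [L2.inner_def]
  refine integral_congr_ae ?_
  filter_upwards [(memLp_const (1 : ℝ) : MemLp _ 2 μ).coeFn_toLp] with x hx
  rw [constOne, hx]; simp

theorem norm_constOne : ‖constOne μ‖ = 1 := by
  have : ‖constOne μ‖ ^ 2 = 1 := by rw [constOne, norm_toLp_sq]; simp
  exact (pow_eq_one_iff_of_nonneg (norm_nonneg _) two_ne_zero).1 this

/-- The kernel `1 - a² + a² K` gives a perturbation of rank one of a multiple of the integral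
operator of `K`. -/
theorem Admissible.norm_adjoint_hat_sq (h : Admissible K μ) (a : unitInterval) (g : Lp ℝ 2 μ) :
    ‖(h.hat a).embed.adjoint g‖ ^ 2 = (1 - (a : ℝ) ^ 2) * ⟪constOne μ, g⟫_ℝ ^ 2 +
      (a : ℝ) ^ 2 * ‖h.embed.adjoint g‖ ^ 2 := by
  have hg : MemLp g 2 μ := Lp.memLp g
  have hgi : Integrable g μ := hg.integrable one_le_two
  have h1 : ∀ x, (h.hat a).embed.adjoint g x =
      (1 - (a : ℝ) ^ 2) * ∫ t, g t ∂μ + (a : ℝ) ^ 2 * h.embed.adjoint g x := fun x => by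
    rw [Admissible.adjoint_apply, Admissible.adjoint_apply, ← integral_const_mul,
      ← integral_const_mul,
      ← integral_add (hgi.const_mul _) ((h.integrable_mul_kernel hg x).const_mul _)]
    refine integral_congr_ae (Filter.Eventually.of_forall fun t => ?_)
    simp only [hatKernel_apply]
    ring
  rw [Admissible.norm_adjoint_sq, Admissible.norm_adjoint_sq, inner_constOne]
  simp only [h1, add_mul]
  have h2 : Integrable (fun x => h.embed.adjoint g x * g x) μ :=
    (h.memLp _).integrable_mul hg
  rw [integral_add (hgi.const_mul _) (by simpa only [mul_assoc] using h2.const_mul _),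
    integral_const_mul]
  simp only [mul_assoc]
  rw [integral_const_mul]
  ring

theorem Admissible.norm_adjoint_constOne_sq (h : Admissible K μ) :
    ‖h.embed.adjoint (constOne μ)‖ ^ 2 = ∫ x, ∫ t, K x t ∂μ ∂μ := by
  have h1 : ∀ᵐ x ∂μ, constOne μ x = 1 := (memLp_const (1 : ℝ) : MemLp _ 2 μ).coeFn_toLp
  rw [h.norm_adjoint_sq]
  refine integral_congr_ae ?_
  filter_upwards [h1] with x hx
  rw [hx, mul_one, h.adjoint_apply]
  refine integral_congr_ae ?_
  filter_upwards [h1] with t ht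
  rw [ht, one_mul, K.symm]

theorem Admissible.eigenvalue_hat_succ_le (h : Admissible K μ) (a : unitInterval) (j : ℕ) :
    eigenvalue (hatKernel a K) μ (j + 1) ≤ (a : ℝ) ^ 2 * eigenvalue K μ j := by
  rw [(h.hat a).eigenvalue_eq, h.eigenvalue_eq]
  exact sqSingular_succ_le_of_rank_one h.hsBound (sq_nonneg _) (h.norm_adjoint_hat_sq a) j

theorem one_sub_sq_nonneg (a : unitInterval) : (0 : ℝ) ≤ 1 - (a : ℝ) ^ 2 := by
  nlinarith [a.2.1, a.2.2]

theorem Admissible.mul_eigenvalue_le_hat (h : Admissible K μ) (a : unitInterval) (j : ℕ) :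
    (a : ℝ) ^ 2 * eigenvalue K μ j ≤ eigenvalue (hatKernel a K) μ j := by
  rw [(h.hat a).eigenvalue_eq, h.eigenvalue_eq]
  exact mul_sqSingular_le_of_rank_one (h.hat a).hsBound (one_sub_sq_nonneg a) (sq_nonneg _)
    (h.norm_adjoint_hat_sq a) j

theorem Admissible.le_eigenvalue_hat_zero (h : Admissible K μ) (a : unitInterval) :
    1 - (a : ℝ) ^ 2 + (a : ℝ) ^ 2 * ∫ x, ∫ t, K x t ∂μ ∂μ ≤ eigenvalue (hatKernel a K) μ 0 := by
  have h1 := norm_adjoint_sq_le_sqSingular_zero (h.hat a).hsBound (constOne μ)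
  rw [h.norm_adjoint_hat_sq a, h.norm_adjoint_constOne_sq, norm_constOne,
    real_inner_self_eq_norm_sq, norm_constOne, ← (h.hat a).eigenvalue_eq] at h1
  simpa using h1

theorem Admissible.hasSum_eigenvalue_hat (h : Admissible K μ)
    (hK : HasSum (fun j => eigenvalue K μ j) 1) (a : unitInterval) :
    HasSum (fun j => eigenvalue (hatKernel a K) μ j) 1 := by
  refine hasSum_of_tsum_ofReal (h.hat a).eigenvalue_nonneg zero_le_one ?_
  have h1 := tsum_ofReal_of_hasSum h.eigenvalue_nonneg hK
  have h2 := tsum_sqSingular_of_rank_one h.hsBound (h.hat a).hsBound (one_sub_sq_nonneg a)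
    (sq_nonneg _) (h.norm_adjoint_hat_sq a)
  simp only [← Admissible.eigenvalue_eq] at h2
  rw [h2, h1, norm_constOne, one_pow, mul_one, ENNReal.ofReal_one, mul_one,
    ← ENNReal.ofReal_add (one_sub_sq_nonneg a) (sq_nonneg _)]
  simp

end Hat

/-! ### Product kernels -/

section Product

variable {X : Type} [MeasurableSpace X] {d : ℕ} {μ : Measure X} [SigmaFinite μ]
  {κ : Fin d → PDKernel X} {P : PDKernel (Fin d → X)}

theorem admissible_of_prod (hP : ∀ x t, P x t = ∏ l, κ l (x l) (t l))
    (hκ : ∀ l, Admissible (κ l) μ) : Admissible P (Measure.pi fun _ => μ) where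
  meas := by
    simp only [hP]
    refine Finset.measurable_prod _ fun l _ => ?_
    have : Measurable fun z : (Fin d → X) × (Fin d → X) => (z.1 l, z.2 l) := by fun_prop
    exact (hκ l).meas.comp this
  int := by
    simp only [hP]
    exact Integrable.fintype_prod fun l => (hκ l).int

theorem memLp_prod {f : Fin d → X → ℝ} (hm : ∀ l, Measurable (f l)) (hf : ∀ l, MemLp (f l) 2 μ) :
    MemLp (fun x : Fin d → X => ∏ l, f l (x l)) 2 (Measure.pi fun _ => μ) := by
  rw [memLp_two_iff_integrable_sq]
  · simp only [← Finset.prod_pow]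
    exact Integrable.fintype_prod (f := fun l y => f l y ^ 2) fun l => (hf l).integrable_sq
  · exact (Finset.measurable_prod _ fun l _ =>
      (hm l).comp (measurable_pi_apply l)).aestronglyMeasurable

/-- The products of the eigenfunctions form a singular system of the product kernel. -/
theorem exists_isSingularSystem_prod (hP : ∀ x t, P x t = ∏ l, κ l (x l) (t l))
    (hκ : ∀ l, Admissible (κ l) μ) (hPa : Admissible P (Measure.pi fun _ => μ))
    {I : Fin d → Type} {η : ∀ l, I l → (κ l).space} {w : ∀ l, I l → ℝ}
    (hs : ∀ l, IsSingularSystem (hκ l).embed (η l) (w l))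
    (hsum : ∀ l, HasSum (w l) (∫ t, κ l t t ∂μ)) :
    ∃ E : (∀ l, I l) → P.space, IsSingularSystem hPa.embed E fun J => ∏ l, w l (J l) := by
  classical
  have hmem : ∀ J : ∀ l, I l, MemLp (fun x : Fin d → X => ∏ l, η l (J l) (x l)) 2
      (Measure.pi fun _ => μ) := fun J =>
    memLp_prod (f := fun l => η l (J l)) (fun l => (hκ l).measurable _) fun l => (hκ l).memLp _
  have hW : ∀ J : ∀ l, I l, 0 < ∏ l, w l (J l) := fun J =>
    Finset.prod_pos fun l _ => (hs l).pos _
  -- the preimage of the product function, which lies in the range of the adjoint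
  let E : (∀ l, I l) → P.space := fun J =>
    (∏ l, w l (J l))⁻¹ • hPa.embed.adjoint ((hmem J).toLp _)
  have hE : ∀ J x, E J x = ∏ l, η l (J l) (x l) := by
    intro J x
    have h1 : hPa.embed.adjoint ((hmem J).toLp _) x = (∏ l, w l (J l)) * ∏ l, η l (J l) (x l) := by
      rw [hPa.adjoint_apply]
      have h2 : ∫ t, ((hmem J).toLp _ : (Fin d → X) → ℝ) t * P t x ∂(Measure.pi fun _ => μ) =
          ∫ t, ∏ l, (η l (J l) (t l) * κ l (x l) (t l)) ∂(Measure.pi fun _ => μ) := by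
        refine integral_congr_ae ?_
        filter_upwards [(hmem J).coeFn_toLp] with t ht
        rw [ht, P.symm, hP, Finset.prod_mul_distrib]
      rw [h2, integral_fintype_prod_eq_prod (fun l (t : X) => η l (J l) t * κ l (x l) t),
        ← Finset.prod_mul_distrib]
      exact Finset.prod_congr rfl fun l _ =>
        ((hκ l).isEigen_iff _ _).2 ((hs l).eigen (J l)) (x l)
    change ((∏ l, w l (J l))⁻¹ • hPa.embed.adjoint ((hmem J).toLp _)) x = _
    rw [RKHS.coe_smul, Pi.smul_apply, h1, smul_eq_mul, inv_mul_cancel_left₀ (hW J).ne']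
  have hembed : ∀ J, hPa.embed (E J) = (hmem J).toLp _ := fun J => by
    rw [hPa.embed_apply]
    congr 1
    exact funext (hE J)
  have heig : ∀ J, hPa.embed.adjoint (hPa.embed (E J)) = (∏ l, w l (J l)) • E J := fun J => by
    rw [hembed, smul_inv_smul₀ (hW J).ne']
  have hinner : ∀ J J', ⟪E J, E J'⟫_ℝ = ∏ l, ⟪η l (J l), η l (J' l)⟫_ℝ := by
    intro J J'
    have h1 : (∏ l, w l (J l)) * ⟪E J, E J'⟫_ℝ = (∏ l, w l (J l)) *
        ∏ l, ⟪η l (J l), η l (J' l)⟫_ℝ := by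
      rw [← inner_image_eq (heig J), hPa.inner_embed, ← Finset.prod_mul_distrib]
      have h2 : ∫ x, E J x * hPa.embed (E J') x ∂(Measure.pi fun _ => μ) =
          ∫ x, ∏ l, (η l (J l) (x l) * η l (J' l) (x l)) ∂(Measure.pi fun _ => μ) := by
        refine integral_congr_ae ?_
        filter_upwards [hPa.coeFn_embed (E J')] with x hx
        rw [hx, hE, hE, Finset.prod_mul_distrib]
      rw [h2, integral_fintype_prod_eq_prod (fun l (t : X) => η l (J l) t * η l (J' l) t)]
      refine Finset.prod_congr rfl fun l _ => ?_
      rw [← inner_image_eq ((hs l).eigen (J l)), (hκ l).inner_embed]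
      refine integral_congr_ae ?_
      filter_upwards [(hκ l).coeFn_embed (η l (J' l))] with x hx
      rw [hx]
    exact mul_left_cancel₀ (hW J).ne' h1
  have horth : Orthonormal ℝ E := by
    rw [orthonormal_iff_ite]
    intro J J'
    rw [hinner]
    simp only [orthonormal_iff_ite.1 (hs _).orthonormal]
    split_ifs with hJ
    · subst hJ; simp
    · obtain ⟨l, hl⟩ := Function.ne_iff.1 hJ
      exact Finset.prod_eq_zero (Finset.mem_univ l) (if_neg hl)
  refine ⟨E, hPa.hsBound.isSingularSystem_of_hasSum horth hW heig ?_⟩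
  have hdiag : ∀ (l : Fin d) (t : X), 0 ≤ κ l t t := fun l t => by
    rw [← (κ l).norm_section_sq]; exact sq_nonneg _
  simp only [hP]
  rw [integral_fintype_prod_eq_prod (fun l (t : X) => κ l t t)]
  refine hasSum_of_tsum_ofReal (fun J => (hW J).le)
    (Finset.prod_nonneg fun l _ => integral_nonneg (hdiag l)) ?_
  rw [ENNReal.ofReal_prod_of_nonneg fun l _ => integral_nonneg (hdiag l)]
  simp only [← tsum_ofReal_of_hasSum (fun i => ((hs _).pos i).le) (hsum _)]
  rw [← tsum_pi_prod]
  exact tsum_congr fun J => ENNReal.ofReal_prod_of_nonneg fun l _ => ((hs l).pos _).le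

/-- If the eigenvalues of all factors exhaust the trace, then the power sums of the eigenvalues are
multiplicative. -/
theorem tsum_eigenvalue_prod_rpow (hP : ∀ x t, P x t = ∏ l, κ l (x l) (t l))
    (hκ : ∀ l, Admissible (κ l) μ)
    (hsum : ∀ l, HasSum (fun j => eigenvalue (κ l) μ j) (∫ t, κ l t t ∂μ)) {s : ℝ} (hs : 0 < s) :
    ∑' n, ENNReal.ofReal (eigenvalue P (Measure.pi fun _ => μ) n ^ s) =
      ∏ l, ∑' j, ENNReal.ofReal (eigenvalue (κ l) μ j ^ s) := by
  choose I η w hsys using fun l => (hκ l).hsBound.exists_isSingularSystem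
  have hPa := admissible_of_prod hP hκ
  have htr : ∀ l {s : ℝ}, 0 < s → ∑' j, ENNReal.ofReal (eigenvalue (κ l) μ j ^ s) =
      ∑' i, ENNReal.ofReal (w l i ^ s) := fun l s hs => by
    simp only [(hκ l).eigenvalue_eq]
    exact (hsys l).tsum_sqSingular_rpow (hκ l).hsBound hs
  have hdiag : ∀ l, 0 ≤ ∫ t, κ l t t ∂μ := fun l => integral_nonneg fun t => by
    rw [← (κ l).norm_section_sq]; exact sq_nonneg _
  have hw : ∀ l, HasSum (w l) (∫ t, κ l t t ∂μ) := fun l => by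
    refine hasSum_of_tsum_ofReal (fun i => ((hsys l).pos i).le) (hdiag l) ?_
    have h1 := htr l one_pos
    simp only [Real.rpow_one] at h1
    rw [← h1]
    refine tsum_ofReal_of_hasSum (fun j => ?_) (hsum l)
    rw [(hκ l).eigenvalue_eq]; exact sqSingular_nonneg _ _
  obtain ⟨E, hE⟩ := exists_isSingularSystem_prod hP hκ hPa hsys hw
  simp only [hPa.eigenvalue_eq]
  rw [hE.tsum_sqSingular_rpow hPa.hsBound hs]
  simp only [htr _ hs]
  rw [← tsum_pi_prod]
  refine tsum_congr fun J => ?_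
  rw [← Real.finsetProd_rpow _ _ fun l _ => ((hsys l).pos _).le]
  exact ENNReal.ofReal_prod_of_nonneg fun l _ => Real.rpow_nonneg ((hsys l).pos _).le _

end Product

/-! ### Power sums of the eigenvalues -/

/-- The inclusion of sequence spaces `ℓ^1 ⊆ ℓ^r` with its norm bound. -/
theorem tsum_rpow_le_rpow_tsum {I : Type} (y : I → ℝ≥0∞) {r : ℝ} (hr : 1 ≤ r) :
    ∑' i, y i ^ r ≤ (∑' i, y i) ^ r := by
  have h : ∀ x : ℝ≥0∞, x ^ r = x * x ^ (r - 1) := fun x => by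
    conv_lhs => rw [show r = 1 + (r - 1) by ring,
      ENNReal.rpow_add_of_nonneg _ _ zero_le_one (sub_nonneg.2 hr), ENNReal.rpow_one]
  rw [h (∑' i, y i), ← ENNReal.tsum_mul_right]
  refine ENNReal.tsum_le_tsum fun i => ?_
  rw [h (y i)]
  exact mul_le_mul_right (ENNReal.rpow_le_rpow (ENNReal.le_tsum i) (sub_nonneg.2 hr)) _

/-- The eigenvalues of the `l`-th factor of the product kernel. -/
noncomputable def hatEig (ρ : ℝ → ℝ) (K : ℝ → PDKernel ℝ) (α : ℕ → unitInterval) (γ : ℕ → ℝ)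
    (l j : ℕ) : ℝ := eigenvalue (hatKernel (α l) (K (γ l))) (densMeasure ρ) j

/-- The eigenvalues of the product kernel in dimension `d`. -/
noncomputable def prodEig (ρ : ℝ → ℝ) (K : ℝ → PDKernel ℝ) (α : ℕ → unitInterval) (γ : ℕ → ℝ)
    (d n : ℕ) : ℝ := eigenvalue (prodKernel K α γ d) (densMeasurePi ρ d) n

/-- The assumptions on the univariate kernels, apart from the bounds on the initial and the later
eigenvalues. -/
structure Setting (ρ : ℝ → ℝ) (K : ℝ → PDKernel ℝ) (γ : ℕ → ℝ) : Prop where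
  prob : IsProbabilityMeasure (densMeasure ρ)
  pos : ∀ l, 0 < γ l
  adm : ∀ l, Admissible (K (γ l)) (densMeasure ρ)
  trace : ∀ l, ∫ t, K (γ l) t t ∂(densMeasure ρ) = 1
  sum : ∀ l, HasSum (fun j => eigenvalue (K (γ l)) (densMeasure ρ) j) 1

section

variable {ρ : ℝ → ℝ} {K : ℝ → PDKernel ℝ} {α : ℕ → unitInterval} {γ : ℕ → ℝ}

theorem tailSum_mul_le (h : Setting ρ K γ) (l : ℕ) (s : ℝ) {r : ℝ} (hr : 1 ≤ r) :
    tailSum K (densMeasure ρ) (s * r) (γ l) ≤ tailSum K (densMeasure ρ) s (γ l) ^ r := by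
  refine le_trans (le_of_eq ?_) (tsum_rpow_le_rpow_tsum _ hr)
  refine tsum_congr fun j => ?_
  have h0 : 0 ≤ eigenvalue (K (γ l)) (densMeasure ρ) (j + 1) / γ l ^ 2 :=
    div_nonneg ((h.adm l).eigenvalue_nonneg _) (sq_nonneg _)
  rw [ENNReal.ofReal_rpow_of_nonneg (Real.rpow_nonneg h0 _) (by linarith), ← Real.rpow_mul h0]

theorem Setting.hat_nonneg (h : Setting ρ K γ) (l j : ℕ) : 0 ≤ hatEig ρ K α γ l j :=
  have := h.prob
  ((h.adm l).hat _).eigenvalue_nonneg j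

theorem Setting.hat_antitone (h : Setting ρ K γ) (l : ℕ) : Antitone (hatEig ρ K α γ l) :=
  have := h.prob
  ((h.adm l).hat _).antitone_eigenvalue

theorem Setting.hat_hasSum (h : Setting ρ K γ) (l : ℕ) : HasSum (hatEig ρ K α γ l) 1 :=
  have := h.prob
  (h.adm l).hasSum_eigenvalue_hat (h.sum l) _

theorem Setting.admissible_prod (h : Setting ρ K γ) (d : ℕ) :
    Admissible (prodKernel K α γ d) (densMeasurePi ρ d) :=
  have := h.prob
  admissible_of_prod (κ := fun l : Fin d => hatKernel (α l) (K (γ l))) (fun _ _ => rfl)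
    fun l => (h.adm l).hat _

theorem Setting.prod_nonneg (h : Setting ρ K γ) (d n : ℕ) : 0 ≤ prodEig ρ K α γ d n :=
  (h.admissible_prod d).eigenvalue_nonneg n

theorem Setting.prod_antitone (h : Setting ρ K γ) (d : ℕ) : Antitone (prodEig ρ K α γ d) :=
  (h.admissible_prod d).antitone_eigenvalue

theorem Setting.errAll_eq (h : Setting ρ K γ) (n d : ℕ) :
    errAll ρ K α γ n d = ENNReal.ofReal √(prodEig ρ K α γ d n) :=
  (h.admissible_prod d).minError_eq n

theorem Setting.tsum_prod_rpow (h : Setting ρ K γ) (d : ℕ) {s : ℝ} (hs : 0 < s) :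
    ∑' n, ENNReal.ofReal (prodEig ρ K α γ d n ^ s) =
      ∏ l : Fin d, ∑' j, ENNReal.ofReal (hatEig ρ K α γ l j ^ s) := by
  have := h.prob
  refine tsum_eigenvalue_prod_rpow (κ := fun l : Fin d => hatKernel (α l) (K (γ l)))
    (fun _ _ => rfl) (fun l => (h.adm l).hat _) (fun l => ?_) hs
  rw [(h.adm l).integral_hat_diag (h.trace l)]
  exact h.hat_hasSum l

theorem Setting.prod_hasSum (h : Setting ρ K γ) (d : ℕ) : HasSum (prodEig ρ K α γ d) 1 := by
  refine hasSum_of_tsum_ofReal (h.prod_nonneg d) zero_le_one ?_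
  have h1 := h.tsum_prod_rpow (α := α) d one_pos
  simp only [Real.rpow_one, tsum_ofReal_of_hasSum (h.hat_nonneg _) (h.hat_hasSum _)] at h1
  rw [h1]
  simp

theorem mul_rpow_scale {a g x s : ℝ} (ha : 0 ≤ a) (hg : 0 < g) (hx : 0 ≤ x) :
    (a ^ 2 * x) ^ s = (a * g) ^ (2 * s) * (x / g ^ 2) ^ s := by
  have : a ^ 2 * x = (a * g) ^ (2 : ℝ) * (x / g ^ 2) := by
    rw [Real.rpow_two]; field_simp
  rw [this, Real.mul_rpow (by positivity) (by positivity), ← Real.rpow_mul (by positivity)]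

theorem tsum_ofReal_scale (h : Setting ρ K γ) (l : ℕ) (s : ℝ) :
    ∑' j, ENNReal.ofReal (((α l : ℝ) ^ 2 * eigenvalue (K (γ l)) (densMeasure ρ) (j + 1)) ^ s) =
      ENNReal.ofReal (((α l : ℝ) * γ l) ^ (2 * s)) * tailSum K (densMeasure ρ) s (γ l) := by
  rw [tailSum, ← ENNReal.tsum_mul_left]
  refine tsum_congr fun j => ?_
  rw [mul_rpow_scale (α l).2.1 (h.pos l) ((h.adm l).eigenvalue_nonneg _)]
  exact ENNReal.ofReal_mul (Real.rpow_nonneg (mul_nonneg (α l).2.1 (h.pos l).le) _)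

theorem Setting.hat_zero_add_one_le (h : Setting ρ K γ) (l j : ℕ) :
    hatEig ρ K α γ l 0 + hatEig ρ K α γ l (j + 1) ≤ 1 := by
  have h1 := sum_le_hasSum {0, j + 1} (fun i _ => h.hat_nonneg l i) (h.hat_hasSum (α := α) l)
  rwa [Finset.sum_pair (Nat.succ_ne_zero j).symm] at h1

/-- An upper bound on the power sums of one factor. The second eigenvalue is controlled by the lower
bound on the first one, the later ones by those of the unperturbed kernel. -/
theorem Setting.tsum_hat_rpow_le (h : Setting ρ K γ) {s : ℝ} (hs : 0 < s) {C₁ C₃ : ℝ} (hC₁ : 0 < C₁)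
    (hC₃ : 0 < C₃) {l : ℕ} (h1 : 1 - C₁ * γ l ^ 2 ≤
      ∫ x, ∫ t, K (γ l) x t ∂(densMeasure ρ) ∂(densMeasure ρ))
    (h3 : tailSum K (densMeasure ρ) s (γ l) ≤ ENNReal.ofReal C₃) :
    ∑' j, ENNReal.ofReal (hatEig ρ K α γ l j ^ s) ≤
      ENNReal.ofReal (1 + (C₁ ^ s + C₃) * ((α l : ℝ) * γ l) ^ (2 * s)) := by
  have := h.prob
  have hu : 0 ≤ (α l : ℝ) * γ l := mul_nonneg (α l).2.1 (h.pos l).le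
  have hpow : 0 ≤ ((α l : ℝ) * γ l) ^ (2 * s) := Real.rpow_nonneg hu _
  have h0 := (h.adm l).le_eigenvalue_hat_zero (α l)
  change _ ≤ hatEig ρ K α γ l 0 at h0
  have e0 : hatEig ρ K α γ l 0 ^ s ≤ 1 :=
    Real.rpow_le_one (h.hat_nonneg l 0)
      (by linarith [h.hat_zero_add_one_le (α := α) l 0, h.hat_nonneg (α := α) l 1]) hs.le
  have e1 : hatEig ρ K α γ l 1 ^ s ≤ C₁ ^ s * ((α l : ℝ) * γ l) ^ (2 * s) := by
    rw [Real.rpow_mul hu, ← Real.mul_rpow hC₁.le (Real.rpow_nonneg hu _), Real.rpow_two]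
    refine Real.rpow_le_rpow (h.hat_nonneg l 1) ?_ hs.le
    have := h.hat_zero_add_one_le (α := α) l 0
    have := mul_le_mul_of_nonneg_left h1 (sq_nonneg (α l : ℝ))
    nlinarith
  have e2 : ∑' j, ENNReal.ofReal (hatEig ρ K α γ l (j + 2) ^ s) ≤
      ENNReal.ofReal (C₃ * ((α l : ℝ) * γ l) ^ (2 * s)) := by
    rw [mul_comm, ENNReal.ofReal_mul hpow]
    refine le_trans (ENNReal.tsum_le_tsum fun j => ?_)
      ((tsum_ofReal_scale (α := α) h l s).le.trans (by gcongr))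
    exact ENNReal.ofReal_le_ofReal (Real.rpow_le_rpow (h.hat_nonneg l _)
      ((h.adm l).eigenvalue_hat_succ_le (α l) (j + 1)) hs.le)
  rw [tsum_eq_zero_add' ENNReal.summable, tsum_eq_zero_add' ENNReal.summable]
  refine (add_le_add (ENNReal.ofReal_le_ofReal e0) (add_le_add (ENNReal.ofReal_le_ofReal e1)
    e2)).trans (le_of_eq ?_)
  rw [← ENNReal.ofReal_add (by positivity) (by positivity),
    ← ENNReal.ofReal_add (by positivity) (by positivity)]
  congr 1; ring

/-- A lower bound on the power sums of one factor for exponents below `1`. All eigenvalues but the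
first one are at most `1 / 2`, so that they gain a factor when raised to the power `s`. -/
theorem Setting.le_tsum_hat_rpow (h : Setting ρ K γ) {s : ℝ} (hs : 0 < s) (hs1 : s < 1) {c : ℝ}
    (hc : 0 < c) {l : ℕ} (hl : ENNReal.ofReal c ≤ tailSum K (densMeasure ρ) s (γ l)) :
    ENNReal.ofReal (1 + (1 - 2 ^ (s - 1)) * c * ((α l : ℝ) * γ l) ^ (2 * s)) ≤
      ∑' j, ENNReal.ofReal (hatEig ρ K α γ l j ^ s) := by
  have := h.prob
  set e := hatEig ρ K α γ l with he
  have hu : 0 ≤ (α l : ℝ) * γ l := mul_nonneg (α l).2.1 (h.pos l).le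
  have hpow : 0 ≤ ((α l : ℝ) * γ l) ^ (2 * s) := Real.rpow_nonneg hu _
  have hθ : (2 : ℝ) ^ (s - 1) < 1 := Real.rpow_lt_one_of_one_lt_of_neg one_lt_two (by linarith)
  have hθ0 : (0 : ℝ) < 2 ^ (s - 1) := by positivity
  have hen : ∀ j, 0 ≤ e j := h.hat_nonneg l
  -- the tail `S = ∑_{j ≥ 1} e_j ^ s`
  have hS : ENNReal.ofReal (c * ((α l : ℝ) * γ l) ^ (2 * s)) ≤
      ∑' j, ENNReal.ofReal (e (j + 1) ^ s) := by
    rw [mul_comm, ENNReal.ofReal_mul hpow]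
    refine le_trans (by gcongr) ((tsum_ofReal_scale (α := α) h l s).ge.trans
      (ENNReal.tsum_le_tsum fun j => ENNReal.ofReal_le_ofReal (Real.rpow_le_rpow ?_ ?_ hs.le)))
    · exact mul_nonneg (sq_nonneg _) ((h.adm l).eigenvalue_nonneg _)
    · exact (h.adm l).mul_eigenvalue_le_hat (α l) (j + 1)
  have hhalf : ∀ j, e (j + 1) ≤ 2 ^ (s - 1) * e (j + 1) ^ s := fun j => by
    have h1 : e (j + 1) ≤ 1 / 2 := by
      have := h.hat_zero_add_one_le (α := α) l j
      have := h.hat_antitone (α := α) l (Nat.zero_le (j + 1))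
      rw [← he] at *
      linarith
    rcases (hen (j + 1)).eq_or_lt with h0 | h0
    · rw [← h0, Real.zero_rpow hs.ne', mul_zero]
    · have h2 : e (j + 1) = e (j + 1) ^ (1 - s) * e (j + 1) ^ s := by
        rw [← Real.rpow_add h0]; simp
      have h3 : e (j + 1) ^ (1 - s) ≤ (1 / 2) ^ (1 - s) :=
        Real.rpow_le_rpow h0.le h1 (by linarith)
      have h4 : ((1 : ℝ) / 2) ^ (1 - s) = 2 ^ (s - 1) := by
        rw [one_div, Real.inv_rpow zero_le_two, ← Real.rpow_neg zero_le_two, neg_sub]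
      rw [h4] at h3
      calc e (j + 1) = e (j + 1) ^ (1 - s) * e (j + 1) ^ s := h2
        _ ≤ _ := by gcongr
  set S := ∑' j, ENNReal.ofReal (e (j + 1) ^ s) with hSdef
  -- `∑_{j ≥ 1} e_j ≤ 2 ^ (s - 1) S`
  have htail : ∑' j, ENNReal.ofReal (e (j + 1)) ≤ ENNReal.ofReal (2 ^ (s - 1)) * S := by
    rw [hSdef, ← ENNReal.tsum_mul_left]
    refine ENNReal.tsum_le_tsum fun j => ?_
    rw [← ENNReal.ofReal_mul hθ0.le]
    exact ENNReal.ofReal_le_ofReal (hhalf j)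
  have hone : ENNReal.ofReal (e 0) + ∑' j, ENNReal.ofReal (e (j + 1)) = 1 := by
    have := tsum_ofReal_of_hasSum hen (h.hat_hasSum l)
    rwa [tsum_eq_zero_add' ENNReal.summable, ENNReal.ofReal_one] at this
  have he0 : ENNReal.ofReal (e 0) ≤ ENNReal.ofReal (e 0 ^ s) := by
    refine ENNReal.ofReal_le_ofReal ?_
    have h1 : e 0 ≤ 1 := by
      linarith [h.hat_zero_add_one_le (α := α) l 0, h.hat_nonneg (α := α) l 1]
    calc e 0 = e 0 ^ (1 : ℝ) := (Real.rpow_one _).symm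
      _ ≤ _ := Real.rpow_le_rpow_of_exponent_ge' (hen 0) h1 hs.le hs1.le
  rw [tsum_eq_zero_add' ENNReal.summable]
  calc ENNReal.ofReal (1 + (1 - 2 ^ (s - 1)) * c * ((α l : ℝ) * γ l) ^ (2 * s))
      = 1 + ENNReal.ofReal (1 - 2 ^ (s - 1)) *
          ENNReal.ofReal (c * ((α l : ℝ) * γ l) ^ (2 * s)) := by
        rw [ENNReal.ofReal_add zero_le_one, ENNReal.ofReal_one, mul_assoc,
          ENNReal.ofReal_mul (by linarith)]
        exact mul_nonneg (mul_nonneg (by linarith) hc.le) hpow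
    _ ≤ 1 + ENNReal.ofReal (1 - 2 ^ (s - 1)) * S := by gcongr
    _ ≤ ENNReal.ofReal (e 0) + ENNReal.ofReal (2 ^ (s - 1)) * S +
        ENNReal.ofReal (1 - 2 ^ (s - 1)) * S := by
        rw [← hone]; gcongr
    _ = ENNReal.ofReal (e 0) + S := by
        rw [add_assoc, ← add_mul, ← ENNReal.ofReal_add hθ0.le (by linarith)]
        simp
    _ ≤ _ := by gcongr

/-- Uniform upper bounds on the power sums of the product kernels. -/
theorem Setting.exists_tsum_prod_rpow_le (h : Setting ρ K γ) {s : ℝ} (hs : 0 < s) {C₁ C₃ : ℝ}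
    (hC₁ : 0 < C₁) (hC₃ : 0 < C₃) (h1 : ∀ l, 1 - C₁ * γ l ^ 2 ≤
      ∫ x, ∫ t, K (γ l) x t ∂(densMeasure ρ) ∂(densMeasure ρ))
    (h3 : ∀ l, tailSum K (densMeasure ρ) s (γ l) ≤ ENNReal.ofReal C₃)
    (hsum : Summable fun l => ((α l : ℝ) * γ l) ^ (2 * s)) :
    ∃ M : ℝ, 0 < M ∧ ∀ d, ∑' n, ENNReal.ofReal (prodEig ρ K α γ d n ^ s) ≤ ENNReal.ofReal M := by
  have hpow : ∀ l, 0 ≤ ((α l : ℝ) * γ l) ^ (2 * s) := fun l =>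
    Real.rpow_nonneg (mul_nonneg (α l).2.1 (h.pos l).le) _
  have hC : 0 ≤ C₁ ^ s + C₃ := by positivity
  refine ⟨Real.exp ((C₁ ^ s + C₃) * ∑' l, ((α l : ℝ) * γ l) ^ (2 * s)), Real.exp_pos _,
    fun d => ?_⟩
  rw [h.tsum_prod_rpow d hs]
  calc ∏ l : Fin d, ∑' j, ENNReal.ofReal (hatEig ρ K α γ l j ^ s)
      ≤ ∏ l : Fin d, ENNReal.ofReal (Real.exp ((C₁ ^ s + C₃) * ((α l : ℝ) * γ l) ^ (2 * s))) := by
        refine Finset.prod_le_prod' fun l _ => ?_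
        refine (h.tsum_hat_rpow_le hs hC₁ hC₃ (h1 l) (h3 l)).trans (ENNReal.ofReal_le_ofReal ?_)
        rw [add_comm]
        exact Real.add_one_le_exp _
    _ = ENNReal.ofReal (Real.exp ((C₁ ^ s + C₃) *
          ∑ l ∈ Finset.range d, ((α l : ℝ) * γ l) ^ (2 * s))) := by
        rw [← ENNReal.ofReal_prod_of_nonneg fun l _ => (Real.exp_pos _).le, ← Real.exp_sum,
          Finset.mul_sum,
          Fin.sum_univ_eq_sum_range (fun l => (C₁ ^ s + C₃) * ((α l : ℝ) * γ l) ^ (2 * s))]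
    _ ≤ _ := by
        gcongr
        exact hsum.sum_le_tsum _ fun l _ => hpow l

/-- Uniform upper bounds on the power sums of the product kernels force summability. -/
theorem Setting.summable_of_tsum_prod_rpow_le (h : Setting ρ K γ) {s : ℝ} (hs : 0 < s)
    (hs1 : s < 1) {c M : ℝ} (hc : 0 < c)
    (hl : ∀ l, ENNReal.ofReal c ≤ tailSum K (densMeasure ρ) s (γ l))
    (hM : ∀ d, 1 ≤ d → ∑' n, ENNReal.ofReal (prodEig ρ K α γ d n ^ s) ≤ ENNReal.ofReal M) :
    Summable fun l => ((α l : ℝ) * γ l) ^ (2 * s) := by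
  have hpow : ∀ l, 0 ≤ ((α l : ℝ) * γ l) ^ (2 * s) := fun l =>
    Real.rpow_nonneg (mul_nonneg (α l).2.1 (h.pos l).le) _
  have hθ : (2 : ℝ) ^ (s - 1) < 1 := Real.rpow_lt_one_of_one_lt_of_neg one_lt_two (by linarith)
  set δ := (1 - 2 ^ (s - 1)) * c with hδ
  have hδ0 : 0 < δ := mul_pos (by linarith) hc
  have key : ∀ d, 1 ≤ d → 1 + δ * ∑ l ∈ Finset.range d, ((α l : ℝ) * γ l) ^ (2 * s) ≤ max M 0 := by
    intro d hd
    have h1 : 1 + δ * ∑ l ∈ Finset.range d, ((α l : ℝ) * γ l) ^ (2 * s) ≤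
        ∏ l ∈ Finset.range d, (1 + δ * ((α l : ℝ) * γ l) ^ (2 * s)) := by
      clear hd
      induction d with
      | zero => simp
      | succ d ih =>
        rw [Finset.sum_range_succ, Finset.prod_range_succ]
        have h2 := mul_nonneg hδ0.le (hpow d)
        have h3 : 0 ≤ δ * ∑ l ∈ Finset.range d, ((α l : ℝ) * γ l) ^ (2 * s) :=
          mul_nonneg hδ0.le (Finset.sum_nonneg fun l _ => hpow l)
        nlinarith [mul_le_mul_of_nonneg_right ih (add_nonneg zero_le_one h2)]
    refine h1.trans ?_
    rw [← ENNReal.ofReal_le_ofReal_iff (le_max_right _ _)]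
    refine le_trans ?_ ((hM d hd).trans (ENNReal.ofReal_le_ofReal (le_max_left _ _)))
    rw [h.tsum_prod_rpow d hs, ← Fin.prod_univ_eq_prod_range
      (fun l => 1 + δ * ((α l : ℝ) * γ l) ^ (2 * s)), ENNReal.ofReal_prod_of_nonneg
      fun (l : Fin d) _ => add_nonneg zero_le_one (mul_nonneg hδ0.le (hpow l))]
    exact Finset.prod_le_prod' fun l _ => h.le_tsum_hat_rpow hs hs1 hc (hl l)
  refine summable_of_sum_range_le (c := max M 0 / δ) hpow fun d => ?_
  rw [le_div_iff₀' hδ0]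
  rcases Nat.eq_zero_or_pos d with rfl | hd
  · simp
  · linarith [key d hd]

end

section

variable {ρ : ℝ → ℝ} {K : ℝ → PDKernel ℝ} {α : ℕ → unitInterval} {γ : ℕ → ℝ}

/-! ### Convergence rates -/

/-- The minimal errors are of order `n ^ (-β)`, uniformly in the dimension. -/
def UniformRate (ρ : ℝ → ℝ) (K : ℝ → PDKernel ℝ) (α : ℕ → unitInterval) (γ : ℕ → ℝ) (β : ℝ) :
    Prop :=
  ∃ M : ℝ, 0 < M ∧ ∀ d n : ℕ, errAll ρ K α γ n d ≤ ENNReal.ofReal (M * ((n : ℝ) + 1) ^ (-β))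

/-- A monotone sequence with bounded power sums decays at the corresponding rate. -/
theorem Setting.uniformRate_of_tsum_le (h : Setting ρ K γ) {β : ℝ} (hβ : 0 < β) {M : ℝ}
    (hM : 0 < M) (hsum : ∀ d, ∑' n, ENNReal.ofReal (prodEig ρ K α γ d n ^ (1 / (2 * β))) ≤
      ENNReal.ofReal M) : UniformRate ρ K α γ β := by
  refine ⟨M ^ β, by positivity, fun d n => ?_⟩
  rw [h.errAll_eq]
  refine ENNReal.ofReal_le_ofReal ?_
  set s := 1 / (2 * β) with hs
  have hs0 : 0 < s := by positivity
  have hnn := h.prod_nonneg (α := α) d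
  have h1 : ((n : ℝ) + 1) * prodEig ρ K α γ d n ^ s ≤ M := by
    rw [← ENNReal.ofReal_le_ofReal_iff hM.le]
    refine le_trans ?_ ((ENNReal.sum_le_tsum (Finset.range (n + 1))).trans (hsum d))
    rw [← ENNReal.ofReal_sum_of_nonneg fun i _ => Real.rpow_nonneg (hnn i) _]
    refine ENNReal.ofReal_le_ofReal ?_
    have h2 := Finset.card_nsmul_le_sum (Finset.range (n + 1))
      (fun i => prodEig ρ K α γ d i ^ s) (prodEig ρ K α γ d n ^ s) fun i hi =>
        Real.rpow_le_rpow (hnn n)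
          (h.prod_antitone d (Nat.lt_succ_iff.1 (Finset.mem_range.1 hi))) hs0.le
    simpa using h2
  have hn : (0 : ℝ) < (n : ℝ) + 1 := by positivity
  have h3 : prodEig ρ K α γ d n ^ s ≤ M * ((n : ℝ) + 1) ^ (-1 : ℝ) := by
    rw [Real.rpow_neg_one, ← div_eq_mul_inv, le_div_iff₀' hn]
    exact h1
  have h4 := Real.rpow_le_rpow (Real.rpow_nonneg (hnn n) s) h3 hβ.le
  rw [Real.mul_rpow hM.le (by positivity), ← Real.rpow_mul (hnn n), ← Real.rpow_mul hn.le,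
    neg_one_mul] at h4
  rw [Real.sqrt_eq_rpow]
  convert h4 using 2
  rw [hs]; field_simp

/-- The rate `1 / 2` comes from the trace alone. -/
theorem Setting.uniformRate_half (h : Setting ρ K γ) : UniformRate ρ K α γ (1 / 2) := by
  refine h.uniformRate_of_tsum_le (by norm_num) one_pos fun d => ?_
  norm_num
  exact (tsum_ofReal_of_hasSum (h.prod_nonneg d) (h.prod_hasSum d)).le.trans (by simp)

theorem mem_shapeRange (hγ : ∀ l, 0 < γ l) (l : ℕ) : γ l ∈ shapeRange γ := ⟨hγ l, l, le_rfl⟩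

/-- The upper bound in `TailCondition` passes to all larger exponents. -/
theorem exists_tailSum_le (h : Setting ρ K γ) {r : ℝ≥0∞}
    (hT : TailCondition K (densMeasure ρ) (shapeRange γ) r) {s : ℝ} (hs : 0 < s)
    (hsr : ENNReal.ofReal (1 / (2 * s)) ≤ r) :
    ∃ C₃ : ℝ, 0 < C₃ ∧ ∀ l, tailSum K (densMeasure ρ) s (γ l) ≤ ENNReal.ofReal C₃ := by
  have hr0 : r ≠ 0 := fun h0 => by
    rw [h0, nonpos_iff_eq_zero, ENNReal.ofReal_eq_zero] at hsr
    exact absurd hsr (not_le.2 (by positivity))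
  by_cases hr : r = ∞
  · obtain ⟨C₃, hC, hb⟩ := hT.2.2 hr s hs
    exact ⟨C₃, hC, fun l => hb _ (mem_shapeRange h.pos l)⟩
  · obtain ⟨C₂, C₃, -, hC, hb⟩ := hT.2.1 hr0 hr
    have hr' : 0 < r.toReal := ENNReal.toReal_pos hr0 hr
    have h1 : 1 / (2 * s) ≤ r.toReal := (ENNReal.ofReal_le_iff_le_toReal hr).1 hsr
    have h2 : 1 ≤ 2 * r.toReal * s := by
      rw [div_le_iff₀ (by positivity)] at h1; linarith
    refine ⟨C₃ ^ (2 * r.toReal * s), by positivity, fun l => ?_⟩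
    have h3 := tailSum_mul_le h l (1 / (2 * r.toReal)) h2
    rw [show 1 / (2 * r.toReal) * (2 * r.toReal * s) = s by field_simp] at h3
    refine h3.trans ?_
    rw [← ENNReal.ofReal_rpow_of_pos hC]
    exact ENNReal.rpow_le_rpow (hb _ (mem_shapeRange h.pos l)).2 (by linarith)

/-- The lower bound in `TailCondition` passes to all smaller exponents; for `r = 0` the second
eigenvalue alone gives it. -/
theorem exists_le_tailSum (h : Setting ρ K γ) {r : ℝ≥0∞}
    (hT : TailCondition K (densMeasure ρ) (shapeRange γ) r) {s : ℝ} (hs : 0 < s)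
    (hsr : r < ENNReal.ofReal (1 / (2 * s))) :
    ∃ c : ℝ, 0 < c ∧ ∀ l, ENNReal.ofReal c ≤ tailSum K (densMeasure ρ) s (γ l) := by
  have hr : r ≠ ∞ := ne_top_of_lt hsr
  by_cases hr0 : r = 0
  · obtain ⟨C₂, C₃, hC, -, hb⟩ := hT.1 hr0
    refine ⟨C₂ ^ s, by positivity, fun l => ?_⟩
    refine le_trans (ENNReal.ofReal_le_ofReal ?_) (ENNReal.le_tsum 0)
    exact Real.rpow_le_rpow hC.le (hb _ (mem_shapeRange h.pos l)).1 hs.le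
  · obtain ⟨C₂, C₃, hC, -, hb⟩ := hT.2.1 hr0 hr
    have hr' : 0 < r.toReal := ENNReal.toReal_pos hr0 hr
    have h1 : r.toReal < 1 / (2 * s) := (ENNReal.lt_ofReal_iff_toReal_lt hr).1 hsr
    have h2 : 1 ≤ 1 / (2 * r.toReal * s) := by
      rw [lt_div_iff₀ (by positivity)] at h1
      rw [le_div_iff₀ (by positivity)]; linarith
    refine ⟨C₂ ^ (2 * r.toReal * s), by positivity, fun l => ?_⟩
    have h3 := tailSum_mul_le h l s h2
    rw [show s * (1 / (2 * r.toReal * s)) = 1 / (2 * r.toReal) by field_simp] at h3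
    have h4 := ENNReal.rpow_le_rpow ((hb _ (mem_shapeRange h.pos l)).1.trans h3)
      (show 0 ≤ 2 * r.toReal * s by positivity)
    rw [← ENNReal.rpow_mul, one_div_mul_cancel (by positivity), ENNReal.rpow_one,
      ENNReal.ofReal_rpow_of_pos hC] at h4
    exact h4

theorem le_decayRate {β : ℝ} (hβ : 0 < β)
    (hsum : Summable fun l => ((α l : ℝ) * γ l) ^ (1 / β)) : ENNReal.ofReal β ≤ decayRate α γ :=
  le_iSup₂_of_le β ⟨hβ, hsum⟩ le_rfl

/-- All rates below `max (decayRate α γ) (1 / 2)` are attained. -/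
theorem Setting.exists_uniformRate (h : Setting ρ K γ)
    (hgtc1 : ∃ C₁ : ℝ, 0 < C₁ ∧ ∀ g ∈ shapeRange γ,
      1 - C₁ * g ^ 2 ≤ ∫ x, ∫ t, K g x t ∂(densMeasure ρ) ∂(densMeasure ρ))
    (hT : TailCondition K (densMeasure ρ) (shapeRange γ) (decayRate α γ)) {b : ℝ}
    (hb : ENNReal.ofReal b < max (decayRate α γ) (1 / 2)) :
    ∃ β, 0 < β ∧ b ≤ β ∧ UniformRate ρ K α γ β := by
  rcases lt_max_iff.1 hb with hb | hb
  · obtain ⟨β, hβ, hlt⟩ := by simpa only [decayRate, lt_iSup_iff] using hb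
    have hbβ : b ≤ β := by
      rw [ENNReal.ofReal_lt_ofReal_iff hβ.1] at hlt
      exact hlt.le
    obtain ⟨C₁, hC₁, h1⟩ := hgtc1
    have hs : 0 < 1 / (2 * β) := by have := hβ.1; positivity
    have h2 : 1 / (2 * (1 / (2 * β))) = β := by have := hβ.1; field_simp
    obtain ⟨C₃, hC₃, h3⟩ := exists_tailSum_le h hT hs (by
      rw [h2]; exact le_decayRate hβ.1 hβ.2)
    obtain ⟨M, hM, hsum⟩ := h.exists_tsum_prod_rpow_le hs hC₁ hC₃
      (fun l => h1 _ (mem_shapeRange h.pos l)) h3 (by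
        rw [show 2 * (1 / (2 * β)) = 1 / β by have := hβ.1; field_simp]; exact hβ.2)
    exact ⟨β, hβ.1, hbβ, h.uniformRate_of_tsum_le hβ.1 hM hsum⟩
  · refine ⟨1 / 2, by norm_num, ?_, h.uniformRate_half⟩
    rw [show (1 / 2 : ℝ≥0∞) = ENNReal.ofReal (1 / 2) by
      rw [ENNReal.ofReal_div_of_pos two_pos]; simp,
      ENNReal.ofReal_lt_ofReal_iff (by norm_num)] at hb
    exact hb.le

theorem UniformRate.complAll_le {β : ℝ} (hβ : 0 < β) (h : UniformRate ρ K α γ β) :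
    ∃ C : ℝ, 0 < C ∧ ∀ (d : ℕ) (ε : ℝ), 0 < ε →
      (complAll ρ K α γ ε d : ℝ≥0∞) ≤ ENNReal.ofReal (C * ε ^ (-(1 / β))) := by
  obtain ⟨M, hM, h⟩ := h
  refine ⟨M ^ (1 / β), by positivity, fun d ε hε => ?_⟩
  have h0 : 0 ≤ M ^ (1 / β) * ε ^ (-(1 / β)) := by positivity
  set n := ⌊M ^ (1 / β) * ε ^ (-(1 / β))⌋₊ with hn
  have h1 : complAll ρ K α γ ε d ≤ n := by
    refine iInf₂_le_of_le n ((h d n).trans (ENNReal.ofReal_le_ofReal ?_)) le_rfl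
    have h2 : M ^ (1 / β) * ε ^ (-(1 / β)) ≤ (n : ℝ) + 1 := (Nat.lt_floor_add_one _).le
    have h3 := Real.rpow_le_rpow_of_nonpos (by positivity) h2 (neg_nonpos.2 hβ.le)
    rw [Real.mul_rpow (by positivity) (by positivity), ← Real.rpow_mul hM.le,
      ← Real.rpow_mul hε.le, show 1 / β * -β = -1 by field_simp,
      show -(1 / β) * -β = 1 by field_simp, Real.rpow_neg_one, Real.rpow_one] at h3
    calc M * ((n : ℝ) + 1) ^ (-β) ≤ M * (M⁻¹ * ε) := by gcongr
      _ = ε := by field_simp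
  calc (complAll ρ K α γ ε d : ℝ≥0∞) ≤ ((n : ℕ∞) : ℝ≥0∞) := by exact_mod_cast h1
    _ = ENNReal.ofReal (n : ℝ) := by simp
    _ ≤ _ := ENNReal.ofReal_le_ofReal (Nat.floor_le h0)

/-! ### Exponents of tractability -/

theorem min_two_inv_inv (r : ℝ≥0∞) : (min 2 r⁻¹)⁻¹ = max r (1 / 2) := by
  rw [one_div]
  rcases le_total 2 r⁻¹ with h | h
  · rw [min_eq_left h, max_eq_right]
    rwa [ENNReal.le_inv_iff_le_inv] at h
  · rw [min_eq_right h, inv_inv, max_eq_left]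
    rwa [ENNReal.inv_le_iff_inv_le] at h

theorem min_two_inv_ne_top (r : ℝ≥0∞) : min 2 r⁻¹ ≠ ∞ :=
  ne_top_of_le_ne_top ENNReal.ofNat_ne_top (min_le_left _ _)

theorem pAll_nonneg (r : ℝ≥0∞) : 0 ≤ pAll r := ENNReal.toReal_nonneg

theorem pAll_le_two (r : ℝ≥0∞) : pAll r ≤ 2 :=
  ENNReal.toReal_le_of_le_ofReal zero_le_two (by simp)

theorem tractBound_of_gt (h : Setting ρ K γ)
    (hgtc1 : ∃ C₁ : ℝ, 0 < C₁ ∧ ∀ g ∈ shapeRange γ,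
      1 - C₁ * g ^ 2 ≤ ∫ x, ∫ t, K g x t ∂(densMeasure ρ) ∂(densMeasure ρ))
    (hT : TailCondition K (densMeasure ρ) (shapeRange γ) (decayRate α γ)) {p : ℝ}
    (hp : pAll (decayRate α γ) < p) : ∃ C : ℝ, 0 < C ∧ TractBound (complAll ρ K α γ) C p 0 := by
  have hp0 : 0 < p := (pAll_nonneg _).trans_lt hp
  have h1 : ENNReal.ofReal (1 / p) < max (decayRate α γ) (1 / 2) := by
    rw [← min_two_inv_inv, one_div, ENNReal.ofReal_inv_of_pos hp0, ENNReal.inv_lt_inv,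
      ENNReal.lt_ofReal_iff_toReal_lt (min_two_inv_ne_top _)]
    exact hp
  obtain ⟨β, hβ, hle, hrate⟩ := h.exists_uniformRate hgtc1 hT h1
  obtain ⟨C, hC, hb⟩ := hrate.complAll_le hβ
  refine ⟨C, hC, fun d _ ε hε hε1 => (hb d ε hε).trans (ENNReal.ofReal_le_ofReal ?_)⟩
  rw [Real.rpow_zero, mul_one]
  refine mul_le_mul_of_nonneg_left (Real.rpow_le_rpow_of_exponent_ge hε hε1.le ?_) hC.le
  rw [neg_le_neg_iff, one_div_le hβ hp0]
  exact hle

theorem tractBound_two (h : Setting ρ K γ) :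
    ∃ C : ℝ, TractBound (complAll ρ K α γ) C 2 0 := by
  obtain ⟨C, hC, hb⟩ := (h.uniformRate_half (α := α)).complAll_le (by norm_num)
  refine ⟨C, fun d _ ε hε hε1 => (hb d ε hε).trans (le_of_eq ?_)⟩
  norm_num

/-- A bound on the information complexity bounds the eigenvalues. -/
theorem Setting.prodEig_le_of_complAll_le (h : Setting ρ K γ) {d n : ℕ} {ε : ℝ} (hε : 0 ≤ ε)
    {x : ℝ} (hc : (complAll ρ K α γ ε d : ℝ≥0∞) ≤ ENNReal.ofReal x) (hx : x < (n : ℝ) + 1) :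
    prodEig ρ K α γ d n ≤ ε ^ 2 := by
  have h1 : (complAll ρ K α γ ε d : ℝ≥0∞) < (((n + 1 : ℕ) : ℕ∞) : ℝ≥0∞) := by
    refine hc.trans_lt ?_
    rw [show (((n + 1 : ℕ) : ℕ∞) : ℝ≥0∞) = ENNReal.ofReal ((n : ℝ) + 1) by
      rw [ENNReal.ofReal_add (by positivity) zero_le_one]; simp]
    exact (ENNReal.ofReal_lt_ofReal_iff (by positivity)).2 hx
  have h2 : complAll ρ K α γ ε d < ((n + 1 : ℕ) : ℕ∞) := by exact_mod_cast h1
  obtain ⟨m, hm, hlt⟩ := by simpa only [complAll, infoComplexity, iInf_lt_iff] using h2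
  have hmn : m ≤ n := Nat.lt_succ_iff.1 (by exact_mod_cast hlt)
  change errAll ρ K α γ m d ≤ _ at hm
  rw [h.errAll_eq, ENNReal.ofReal_le_ofReal_iff hε, Real.sqrt_le_left hε] at hm
  exact (h.prod_antitone d hmn).trans hm

theorem Setting.prodEig_le_one (h : Setting ρ K γ) (d n : ℕ) : prodEig ρ K α γ d n ≤ 1 := by
  simpa using sum_le_hasSum {n} (fun i _ => h.prod_nonneg d i) (h.prod_hasSum (α := α) d)

/-- A negative exponent is never admissible, since the zero algorithm has a positive error. This is
the lower bound on the exponent when the decay rate is infinite. -/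
theorem Setting.nonneg_of_tractBound (h : Setting ρ K γ) {C p : ℝ}
    (hb : TractBound (complAll ρ K α γ) C p 0) : 0 ≤ p := by
  by_contra! hp
  -- otherwise the initial error would vanish
  have h0 : prodEig ρ K α γ 1 0 = 0 := by
    refine le_antisymm (le_of_forall_pos_le_add fun δ hδ => ?_) (h.prod_nonneg 1 0)
    rw [zero_add]
    have hlim : Filter.Tendsto (fun ε : ℝ => C * ((1 : ℕ) : ℝ) ^ (0 : ℝ) * ε ^ (-p))
        (nhdsWithin 0 (Set.Ioi 0)) (nhds 0) := by
      have h1 : Filter.Tendsto (fun ε : ℝ => ε ^ (-p)) (nhds 0) (nhds 0) := by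
        have := (Real.continuousAt_rpow_const 0 (-p) (Or.inr (by linarith))).tendsto
        rwa [Real.zero_rpow (by linarith)] at this
      simpa using (h1.mono_left nhdsWithin_le_nhds).const_mul (C * ((1 : ℕ) : ℝ) ^ (0 : ℝ))
    have hsq : Filter.Tendsto (fun ε : ℝ => ε ^ 2) (nhdsWithin 0 (Set.Ioi 0)) (nhds 0) := by
      have : Filter.Tendsto (fun ε : ℝ => ε ^ 2) (nhds 0) (nhds (0 ^ 2)) :=
        (continuous_pow 2).tendsto 0
      rw [zero_pow two_ne_zero] at this
      exact this.mono_left nhdsWithin_le_nhds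
    have h1 : ∀ᶠ ε in nhdsWithin (0 : ℝ) (Set.Ioi 0), ε < 1 :=
      nhdsWithin_le_nhds (gt_mem_nhds one_pos)
    obtain ⟨ε, hx, hsmall, hε1, hε⟩ := ((hlim.eventually (gt_mem_nhds one_pos)).and
      ((hsq.eventually (gt_mem_nhds hδ)).and (h1.and self_mem_nhdsWithin))).exists
    have hε' : 0 < ε := hε
    exact (h.prodEig_le_of_complAll_le hε'.le (hb 1 le_rfl ε hε' hε1)
      (by simpa using hx)).trans hsmall.le
  have h1 : ∀ n, prodEig ρ K α γ 1 n = 0 := fun n =>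
    le_antisymm (h0 ▸ h.prod_antitone 1 (Nat.zero_le n)) (h.prod_nonneg 1 n)
  have h2 := h.prod_hasSum (α := α) 1
  rw [show prodEig ρ K α γ 1 = fun _ => 0 from funext h1] at h2
  exact zero_ne_one (hasSum_zero.unique h2)

theorem Setting.prodEig_le_of_tractBound (h : Setting ρ K γ) {C p : ℝ} (hp : 0 < p) (hC : 0 < C)
    (hb : TractBound (complAll ρ K α γ) C p 0) {d : ℕ} (hd : 1 ≤ d) (n : ℕ) :
    prodEig ρ K α γ d n ≤ (2 * C / ((n : ℝ) + 1)) ^ (2 / p) := by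
  have hn : (0 : ℝ) < (n : ℝ) + 1 := by positivity
  rcases le_or_gt ((n : ℝ) + 1) (2 * C) with hle | hlt
  · refine (h.prodEig_le_one d n).trans (Real.one_le_rpow ?_ (by positivity))
    rwa [one_le_div hn]
  · -- the choice of `ε` makes the bound on the information complexity equal to `(n + 1) / 2`
    set b := 2 * C / ((n : ℝ) + 1) with hbdef
    have hb0 : 0 < b := by positivity
    have hb1 : b < 1 := by rwa [hbdef, div_lt_one hn]
    have hε : 0 < b ^ (1 / p) := by positivity
    have h1 := h.prodEig_le_of_complAll_le (n := n) hε.le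
      (hb d hd _ hε (Real.rpow_lt_one hb0.le hb1 (by positivity))) (by
        rw [Real.rpow_zero, mul_one, ← Real.rpow_mul hb0.le,
          show 1 / p * -p = -1 by field_simp, Real.rpow_neg_one, hbdef, inv_div]
        rw [show C * (((n : ℝ) + 1) / (2 * C)) = ((n : ℝ) + 1) / 2 by field_simp]
        linarith)
    refine h1.trans (le_of_eq ?_)
    rw [← Real.rpow_natCast, ← Real.rpow_mul hb0.le]
    congr 1
    push_cast
    ring

theorem TractBound.mono {N : ℝ → ℕ → ℕ∞} {C p p' : ℝ} (hb : TractBound N C p 0) (hp : p ≤ p') :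
    TractBound N (max C 1) p' 0 := by
  intro d hd ε hε hε1
  refine (hb d hd ε hε hε1).trans (ENNReal.ofReal_le_ofReal ?_)
  simp only [Real.rpow_zero, mul_one]
  exact mul_le_mul (le_max_left _ _)
    (Real.rpow_le_rpow_of_exponent_ge hε hε1.le (neg_le_neg hp)) (by positivity)
    (zero_le_one.trans (le_max_right _ _))

/-- No exponent below `pAll` is admissible: a bound on the information complexity bounds the power
sums of the eigenvalues uniformly in the dimension, which makes the weights summable to a power
that the definition of the decay rate excludes. -/
theorem Setting.pAll_le_of_tractBound (h : Setting ρ K γ)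
    (hT : TailCondition K (densMeasure ρ) (shapeRange γ) (decayRate α γ)) {C p : ℝ}
    (hb : TractBound (complAll ρ K α γ) C p 0) : pAll (decayRate α γ) ≤ p := by
  have hp0 := h.nonneg_of_tractBound hb
  by_contra! hlt
  obtain ⟨p₁, hp₁, hp₁'⟩ := exists_between hlt
  obtain ⟨p₂, hp₂, hp₂'⟩ := exists_between hp₁'
  have hp₁0 : 0 < p₁ := hp0.trans_lt hp₁
  have hp₂0 : 0 < p₂ := hp₁0.trans hp₂
  have hC : 0 < max C 1 := zero_lt_one.trans_le (le_max_right _ _)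
  have hs0 : 0 < p₂ / 2 := by positivity
  have hs1 : p₂ / 2 < 1 := by linarith [pAll_le_two (decayRate α γ)]
  have hr : decayRate α γ < ENNReal.ofReal (1 / p₂) := by
    rw [pAll, ← ENNReal.ofReal_lt_iff_lt_toReal hp₂0.le (min_two_inv_ne_top _)] at hp₂'
    rw [one_div, ENNReal.ofReal_inv_of_pos hp₂0, ENNReal.lt_inv_iff_lt_inv]
    exact hp₂'.trans_le (min_le_right _ _)
  obtain ⟨c, hc, hl⟩ := exists_le_tailSum h hT hs0 (by rwa [mul_div_cancel₀ _ two_ne_zero])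
  set a : ℕ → ℝ := fun n => (2 * max C 1 / ((n : ℝ) + 1)) ^ (p₂ / p₁) with ha
  have hasum : Summable a := by
    have h1 := (summable_nat_add_iff 1).2
      (Real.summable_one_div_nat_rpow.2 ((one_lt_div hp₁0).2 hp₂))
    refine (h1.mul_left ((2 * max C 1) ^ (p₂ / p₁))).congr fun n => ?_
    rw [ha]
    simp only [Nat.cast_add, Nat.cast_one]
    rw [Real.div_rpow (by positivity) (by positivity)]
    ring
  refine not_le.2 hr (le_decayRate (by positivity) ?_)
  have h2 := h.summable_of_tsum_prod_rpow_le (α := α) hs0 hs1 (M := ∑' n, a n) hc hl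
    fun d hd => by
      rw [ENNReal.ofReal_tsum_of_nonneg (fun n => by rw [ha]; positivity) hasum]
      refine ENNReal.tsum_le_tsum fun n => ENNReal.ofReal_le_ofReal ?_
      refine (Real.rpow_le_rpow (h.prod_nonneg d n)
        (h.prodEig_le_of_tractBound hp₁0 hC (hb.mono hp₁.le) hd n) hs0.le).trans (le_of_eq ?_)
      rw [ha, ← Real.rpow_mul (by positivity)]
      congr 1
      field_simp
  rw [one_div_one_div]
  rwa [mul_div_cancel₀ _ two_ne_zero] at h2

theorem Setting.precN (h : Setting ρ K γ)
    (hgtc1 : ∃ C₁ : ℝ, 0 < C₁ ∧ ∀ g ∈ shapeRange γ,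
      1 - C₁ * g ^ 2 ≤ ∫ x, ∫ t, K g x t ∂(densMeasure ρ) ∂(densMeasure ρ))
    (hT : TailCondition K (densMeasure ρ) (shapeRange γ) (decayRate α γ)) :
    PrecN (errAll ρ K α γ) (-((max (decayRate α γ) (1 / 2) : ℝ≥0∞) : EReal)) := by
  intro s hs
  have h1 : ENNReal.ofReal (-s) < max (decayRate α γ) (1 / 2) := by
    rcases le_total 0 s with h0 | h0
    · rw [ENNReal.ofReal_of_nonpos (by linarith)]
      exact lt_of_lt_of_le (by simp) (le_max_right _ _)
    · rw [EReal.neg_lt_comm] at hs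
      rw [← EReal.coe_ennreal_lt_coe_ennreal_iff, EReal.coe_ennreal_ofReal,
        max_eq_left (by linarith)]
      simpa using hs
  obtain ⟨β, hβ, hle, M, hM, hb⟩ := h.exists_uniformRate hgtc1 hT h1
  refine ⟨M, hM, fun d _ n hn => (hb d n).trans (ENNReal.ofReal_le_ofReal ?_)⟩
  have hn' : (1 : ℝ) ≤ n := by exact_mod_cast hn
  refine mul_le_mul_of_nonneg_left ?_ hM.le
  calc ((n : ℝ) + 1) ^ (-β) ≤ (n : ℝ) ^ (-β) :=
        Real.rpow_le_rpow_of_nonpos (by linarith) (by linarith) (by linarith)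
    _ ≤ _ := Real.rpow_le_rpow_of_exponent_le hn' (by linarith)

end

theorem decayRate_const {α : ℕ → unitInterval} {γ : ℕ → ℝ} {a : unitInterval} {g : ℝ}
    (ha : 0 < (a : ℝ)) (hg : 0 < g) (hα : ∀ l, α l = a) (hγ : ∀ l, γ l = g) :
    decayRate α γ = 0 := by
  simp only [decayRate, ENNReal.iSup_eq_zero]
  rintro β ⟨-, hsum⟩
  simp only [hα, hγ] at hsum
  rw [summable_const_iff] at hsum
  exact absurd hsum (Real.rpow_pos_of_pos (mul_pos ha hg) _).ne'

theorem pAll_zero : pAll 0 = 2 := by simp [pAll]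

theorem Setting.of_assumptions (ρ : ℝ → ℝ) (hρ_one : ∫⁻ x, ENNReal.ofReal (ρ x) = 1)
    (K : ℝ → PDKernel ℝ)
    (hK_meas : ∀ g : ℝ, 0 < g → Measurable fun z : ℝ × ℝ => K g z.1 z.2)
    (hK_trace : ∀ g : ℝ, 0 < g → ∫ t, K g t t ∂(densMeasure ρ) = 1)
    (hK_sum : ∀ g : ℝ, 0 < g → HasSum (fun j => eigenvalue (K g) (densMeasure ρ) j) 1)
    (γ : ℕ → ℝ) (hγ : ∀ l, 0 < γ l) : Setting ρ K γ where
  prob := ⟨by rw [densMeasure, withDensity_apply _ MeasurableSet.univ, Measure.restrict_univ,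
    hρ_one]⟩
  pos := hγ
  adm l := ⟨hK_meas _ (hγ l), by
    -- the integral of a function that is not integrable would be `0`
    by_contra hni
    have := hK_trace _ (hγ l)
    rw [integral_undef hni] at this
    exact zero_ne_one this⟩
  trace l := hK_trace _ (hγ l)
  sum l := hK_sum _ (hγ l)

end ProductKernelApprox

open ProductKernelApprox in
theorem theorem1
    (ρ : ℝ → ℝ) (hρ_meas : Measurable ρ) (hρ_nonneg : ∀ x, 0 ≤ ρ x)
    (hρ_one : ∫⁻ x, ENNReal.ofReal (ρ x) = 1)
    (K : ℝ → PDKernel ℝ)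
    (hK_meas : ∀ g : ℝ, 0 < g → Measurable fun z : ℝ × ℝ => K g z.1 z.2)
    (hK_trace : ∀ g : ℝ, 0 < g → ∫ t, K g t t ∂(densMeasure ρ) = 1)
    (hK_sum : ∀ g : ℝ, 0 < g → HasSum (fun j => eigenvalue (K g) (densMeasure ρ) j) 1)
    (α : ℕ → unitInterval) (γ : ℕ → ℝ) (hγ : ∀ l, 0 < γ l)
    (hgtc1 : ∃ C₁ : ℝ, 0 < C₁ ∧ ∀ g ∈ shapeRange γ,
      1 - C₁ * g ^ 2 ≤ ∫ x, ∫ t, K g x t ∂(densMeasure ρ) ∂(densMeasure ρ))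
    (hgtc2 : TailCondition K (densMeasure ρ) (shapeRange γ) (decayRate α γ)) :
    (StrongPolyTractable (complAll ρ K α γ) ∧
      IsStrongExponent (complAll ρ K α γ) (pAll (decayRate α γ))) ∧
    (PrecN (errAll ρ K α γ) (-((max (decayRate α γ) (1 / 2) : ℝ≥0∞) : EReal)) ∧
      (min 2 (decayRate α γ)⁻¹)⁻¹ = max (decayRate α γ) (1 / 2)) ∧
    PrecEps (complAll ρ K α γ) (-(pAll (decayRate α γ) : EReal)) ∧
    (∀ (a : unitInterval) (g : ℝ), 0 < (a : ℝ) → (∀ l, α l = a) → (∀ l, γ l = g) →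
      IsStrongExponent (complAll ρ K α γ) 2 ∧
        (StrongPolyTractable (complAll ρ K α γ) ↔ PolyTractable (complAll ρ K α γ))) := by
  have h := Setting.of_assumptions ρ hρ_one K hK_meas hK_trace hK_sum γ hγ
  have hstrong : StrongPolyTractable (complAll ρ K α γ) := by
    obtain ⟨C, hC⟩ := tractBound_two (α := α) h
    exact ⟨C, 2, hC⟩
  have hexp : IsStrongExponent (complAll ρ K α γ) (pAll (decayRate α γ)) := by
    refine ⟨fun p hp => ?_, fun b hb => le_of_forall_gt_imp_ge_of_dense fun p hp => ?_⟩
    · obtain ⟨C, hC⟩ := hp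
      exact h.pAll_le_of_tractBound hgtc2 hC
    · obtain ⟨C, -, hC⟩ := tractBound_of_gt h hgtc1 hgtc2 hp
      exact hb ⟨C, hC⟩
  refine ⟨⟨hstrong, hexp⟩, ⟨h.precN hgtc1 hgtc2, min_two_inv_inv _⟩, fun s hs => ?_,
    fun a g ha hα hg => ⟨?_, fun _ => ?_, fun _ => hstrong⟩⟩
  · rw [neg_neg, EReal.coe_lt_coe_iff] at hs
    obtain ⟨C, hC, hb⟩ := tractBound_of_gt h hgtc1 hgtc2 hs
    refine ⟨C, hC, fun d hd ε hε hε1 => (hb d hd ε hε hε1).trans (le_of_eq ?_)⟩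
    rw [Real.rpow_zero, mul_one, one_div, Real.inv_rpow hε.le, Real.rpow_neg hε.le]
  · rwa [decayRate_const ha (hg 0 ▸ hγ 0) hα hg, pAll_zero] at hexp
  · obtain ⟨C, p, hC⟩ := hstrong
    exact ⟨C, p, 0, hC⟩
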